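/- **Theorem 2.1.** Let $\theta:\mathbb R^d\to[0,\infty)$ be a measurable function which is radially decreasing (that is, $\theta(x)\le\theta(y)$ whenever $\|x\|\ge\|y\|$; in particular $\theta$ is radial), with $\lim_{\|\xi\|\to\infty}\theta(\xi)=0$, and let $$I=\int_{\|\xi\|\ge 1}\frac{\theta(\xi)}{\|\xi\|^d}\,d\xi\in[0,\infty].$$ For $f\in L^1(\mathbb R^d)$ put $\widehat f(\xi)=\int_{\mathbb R^d}f(x)e^{-2\pi i x\cdot\xi}\,dx$, and extend the Fourier transform as usual to $L^p(\mathbb R^d)$, $1<p\le 2$. Consider the conditions $$(1)\quad \int_{\mathbb R^d}\frac{|\widehat f(\xi)|^q\,e^{q\theta(\xi)\|\xi\|}}{(1+\|\xi\|)^N}\,d\xi<\infty,\qquad\qquad (2)\quad |\widehat f(\xi)|\le C\,|P(\xi)|\,e^{-\theta(\xi)\|\xi\|}\ \text{ for almost every }\xi\in\mathbb R^d.$$ (a) Let $f\in L^p(\mathbb R^d)$ with $p\in[1,2]$ be such that (1) holds for some real $q\in[1,\infty)$ and $N\ge 0$, or (2) holds for some constant $C$ and some polynomial $P$ with complex coefficients.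 If $f$ vanishes (almost everywhere) on a nonempty open subset of $\mathbb R^d$ and $I=\infty$, then $f=0$ almost everywhere on $\mathbb R^d$. (b) If $I<\infty$, then for all real $q\in[1,\infty)$ and $N\ge 0$ there exists a function $f\in C_c^\infty(\mathbb R^d)$, not identically zero, satisfying (1); and for every polynomial $P\neq 0$ with complex coefficients there exist $f\in C_c^\infty(\mathbb R^d)$, not identically zero, and a constant $C$ satisfying (2). -/

import Mathlib

open MeasureTheory Filter Topology FourierTransform
open scoped ENNReal ContDiff

/-- The Euclidean space `ℝ^d`, with its Euclidean norm and Lebesgue measure. -/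
abbrev Rd (d : ℕ) : Type := EuclideanSpace ℝ (Fin d)

/-- A function on `ℝ^d` is radially decreasing if `θ x ≤ θ y` whenever `‖x‖ ≥ ‖y‖`.
Such a function is radial: take `‖x‖ = ‖y‖` and use the inequality in both directions. -/
def RadiallyDecreasing {d : ℕ} (θ : Rd d → ℝ) : Prop :=
  ∀ x y : Rd d, ‖y‖ ≤ ‖x‖ → θ x ≤ θ y

/-- The integral `I = ∫_{‖ξ‖ ≥ 1} θ(ξ) / ‖ξ‖^d dξ ∈ [0, ∞]` of a nonnegative function `θ`. -/
noncomputable def inghamIntegral {d : ℕ} (θ : Rd d → ℝ) : ℝ≥0∞ :=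
  ∫⁻ ξ in {ξ : Rd d | 1 ≤ ‖ξ‖}, ENNReal.ofReal (θ ξ / ‖ξ‖ ^ d)

/-- The part of `f` where `|f| > 1`; it is in `L¹` if `f ∈ L^p` with `1 ≤ p < ∞`. -/
noncomputable def largePart {d : ℕ} (f : Rd d → ℂ) : Rd d → ℂ :=
  {x | 1 < ‖f x‖}.indicator f

/-- The part of `f` where `|f| ≤ 1`; it is in `L²` if `f ∈ L^p` with `p ≤ 2`. -/
noncomputable def smallPart {d : ℕ} (f : Rd d → ℂ) : Rd d → ℂ :=
  {x | ‖f x‖ ≤ 1}.indicator f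

theorem largePart_add_smallPart {d : ℕ} (f : Rd d → ℂ) : largePart f + smallPart f = f := by
  funext x
  by_cases h : 1 < ‖f x‖
  · simp [largePart, smallPart, Set.indicator, h, not_le.mpr h]
  · simp [largePart, smallPart, Set.indicator, h, not_lt.mp h]

theorem integrable_largePart {d : ℕ} {f : Rd d → ℂ} {p : ℝ≥0∞} (hp1 : 1 ≤ p) (hp2 : p ≤ 2)
    (hf : MemLp f p volume) : Integrable (largePart f) volume := by
  have hp0 : p ≠ 0 := (zero_lt_one.trans_le hp1).ne'
  have hpt : p ≠ ⊤ := (hp2.trans_lt ENNReal.ofNat_lt_top).ne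
  have h1 : 1 ≤ p.toReal := by
    simpa using (ENNReal.toReal_le_toReal ENNReal.one_ne_top hpt).mpr hp1
  refine (hf.integrable_norm_rpow hp0 hpt).mono
    (hf.1.indicator₀ (nullMeasurableSet_lt aemeasurable_const hf.1.norm.aemeasurable)) ?_
  refine Eventually.of_forall fun x => ?_
  rw [Real.norm_of_nonneg (by positivity)]
  by_cases h : 1 < ‖f x‖
  · simpa [largePart, h] using Real.rpow_le_rpow_of_exponent_le h.le h1
  · simp only [largePart, Set.indicator, Set.mem_ofPred_eq, h, if_false, norm_zero]
    positivity

theorem memLp_smallPart {d : ℕ} {f : Rd d → ℂ} {p : ℝ≥0∞} (hp1 : 1 ≤ p) (hp2 : p ≤ 2)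
    (hf : MemLp f p volume) : MemLp (smallPart f) 2 volume := by
  have hp0 : p ≠ 0 := (zero_lt_one.trans_le hp1).ne'
  have hpt : p ≠ ⊤ := (hp2.trans_lt ENNReal.ofNat_lt_top).ne
  have h2 : p.toReal ≤ 2 := by
    simpa using (ENNReal.toReal_le_toReal hpt ENNReal.ofNat_ne_top).mpr hp2
  have hpos : 0 < p.toReal := ENNReal.toReal_pos hp0 hpt
  have hm : AEStronglyMeasurable (smallPart f) volume :=
    hf.1.indicator₀ (nullMeasurableSet_le hf.1.norm.aemeasurable aemeasurable_const)
  rw [memLp_two_iff_integrable_sq_norm hm]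
  refine (hf.integrable_norm_rpow hp0 hpt).mono (hm.norm.pow 2) ?_
  refine Eventually.of_forall fun x => ?_
  rw [Real.norm_of_nonneg (by positivity), Real.norm_of_nonneg (by positivity)]
  by_cases h : ‖f x‖ ≤ 1
  · simp only [smallPart, Set.indicator, Set.mem_ofPred_eq, h, if_true]
    rw [← Real.rpow_two]
    exact Real.rpow_le_rpow_of_exponent_ge' (norm_nonneg _) h hpos.le h2
  · simp only [smallPart, Set.indicator, Set.mem_ofPred_eq, h, if_false, norm_zero]
    simpa using Real.rpow_nonneg (norm_nonneg (f x)) p.toReal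

/-- The Fourier transform `f̂` of `f ∈ L^p(ℝ^d)`, `1 ≤ p ≤ 2` (as a function defined up to null
sets): split `f = f₁ + f₂` with `f₁ ∈ L¹` and `f₂ ∈ L²`, and add the absolutely convergent integral
`f̂₁(ξ) = ∫ f₁(x) e^{-2πi x·ξ} dx` and the Plancherel transform of `f₂` (the extension to `L²` by
continuity from the Schwartz space). The result does not depend, almost everywhere, on the
splitting, because the two transforms agree on `L¹ ∩ L²`. -/
noncomputable def lpFourier {d : ℕ} {f : Rd d → ℂ} {p : ℝ≥0∞} (hp1 : 1 ≤ p) (hp2 : p ≤ 2)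
    (hf : MemLp f p volume) : Rd d → ℂ :=
  fun ξ => 𝓕 (largePart f) ξ +
    (𝓕 ((memLp_smallPart hp1 hp2 hf).toLp (smallPart f)) : Lp ℂ 2 (volume : Measure (Rd d))) ξ

/-- `∫ |g(ξ)|^q e^{q θ(ξ) ‖ξ‖} / (1 + ‖ξ‖)^N dξ < ∞`. -/
def WeightedDecay {d : ℕ} (θ : Rd d → ℝ) (q N : ℝ) (g : Rd d → ℂ) : Prop :=
  ∫⁻ ξ, ENNReal.ofReal (‖g ξ‖ ^ q * Real.exp (q * θ ξ * ‖ξ‖) / (1 + ‖ξ‖) ^ N) < ⊤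

/-- `|g(ξ)| ≤ C |P(ξ)| e^{-θ(ξ) ‖ξ‖}` for almost every `ξ`. -/
def PointwiseDecay {d : ℕ} (θ : Rd d → ℝ) (C : ℝ) (P : MvPolynomial (Fin d) ℂ)
    (g : Rd d → ℂ) : Prop :=
  ∀ᵐ ξ : Rd d, ‖g ξ‖ ≤ C * ‖MvPolynomial.eval (fun i => (ξ i : ℂ)) P‖ * Real.exp (-(θ ξ * ‖ξ‖))

/-! Write θ(ξ) = φ(‖ξ‖). Comparing volumes on shells and applying Cauchy condensation, I is finite
exactly when Σ φ(n^p)/n converges, for each fixed p ≥ 1 (when d ≠ 0). The exponent p = 1 serves the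
construction and p = 4 the uniqueness theorem.

Uniqueness is quasi-analyticity. If G is integrable against exp(2φ(‖ξ‖)‖ξ‖), differentiating under
the integral bounds the n-th derivative of its inverse transform along a line by a constant times
sup_r r^n exp(-2φ(r)r). If φ(r) ≥ 1/√(1+r), this supremum is at most a constant times ∏_{j<n}
(j+1)/φ((j+1)^4) (`exists_pow_mul_exp_le_prod`). Since Σ φ(n^4)/n diverges, the Denjoy–Carleman
theorem (`eq_zero_of_bang`) applies: an inverse transform vanishing on a ball vanishes everywhere.

The transform of f itself is controlled only up to polynomial factors, so f is first smoothed. Let g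
be a test function of small support with transform bounded by a constant times exp(-3√(1+‖ξ‖)). For
each η the product G(ξ) = f̂(ξ) ĝ(ξ-η) has enough decay, and its inverse transform is f convolved
with a modulated copy of g, hence zero on a smaller ball. So G = 0 almost everywhere; as ĝ ≠ 0 near
0 and η is arbitrary, f̂ = 0 and then f = 0.

For existence, Ingham's infinite convolution of bumps of radii comparable to φ(n)/n has compact
support because Σ φ(n)/n converges. At ξ, about φ(‖ξ‖)‖ξ‖ factors of its transform are at most 1/e,
which yields exp(-φ(‖ξ‖)‖ξ‖) (`exists_contDiff_fourier_le_exp`). Adding 1/√(1+r) to φ gains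
integrability; applying a differential operator inserts the polynomial P. -/

open scoped SchwartzMap Convolution LineDeriv

/-! ### Quasi-analyticity: Bang's proof of the Denjoy–Carleman theorem -/

/-- One step of Bang's propagation estimate: closeness to zero at level `N + 1` at `x` gives
closeness at level `N` up to distance `1 / (e * μ N)`. -/
theorem bang_step {E : Type*} [NormedAddCommGroup E] [NormedSpace ℝ E] {g : ℕ → ℝ → E}
    {μ : ℕ → ℝ} {C : ℝ} (hμ0 : ∀ n, 0 < μ n) (hμ : Monotone μ) (hC : 0 ≤ C)
    (hder : ∀ n t, HasDerivAt (g n) (g (n + 1) t) t)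
    (hb : ∀ n t, ‖g n t‖ ≤ C * ∏ j ∈ Finset.range n, μ j) {N : ℕ} {x y : ℝ} (hxy : x ≤ y)
    (hd : y - x ≤ 1 / (Real.exp 1 * μ N))
    (hx : ∀ n, ‖g n x‖ ≤ C * (∏ j ∈ Finset.range n, μ j) * Real.exp (n - (N + 1))) :
    ∀ n, ‖g n y‖ ≤ C * (∏ j ∈ Finset.range n, μ j) * Real.exp (n - N) := by
  have hM : ∀ n, 0 ≤ C * ∏ j ∈ Finset.range n, μ j := fun n =>
    mul_nonneg hC (Finset.prod_nonneg fun j _ => (hμ0 j).le)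
  -- Downward induction on the order n of the derivative, starting at N + 1, where the global bound
  -- suffices. Below that, the bound on `g (n + 1)` is at most the derivative of the comparison
  -- function because μ n ≤ μ N.
  have key : ∀ k n : ℕ, n + k = N + 1 → ∀ z ∈ Set.Icc x y,
      ‖g n z‖ ≤ C * (∏ j ∈ Finset.range n, μ j) * Real.exp (n - (N + 1)) *
        Real.exp (Real.exp 1 * μ N * (z - x)) := by
    intro k
    induction k with
    | zero =>
      intro n hn z hz
      refine (hb n z).trans ?_
      have h1 : (n : ℝ) - (N + 1) = 0 := by
        have : (n : ℝ) = N + 1 := by exact_mod_cast hn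
        linarith
      rw [h1, Real.exp_zero, mul_one]
      refine le_mul_of_one_le_right (hM n) (Real.one_le_exp ?_)
      exact mul_nonneg (mul_nonneg (Real.exp_pos _).le (hμ0 N).le) (sub_nonneg.2 hz.1)
    | succ k ih =>
      intro n hn
      refine image_norm_le_of_norm_deriv_right_le_deriv_boundary
        (f' := g (n + 1))
        (B' := fun z => C * (∏ j ∈ Finset.range n, μ j) * Real.exp (n - (N + 1)) *
          (Real.exp (Real.exp 1 * μ N * (z - x)) * (Real.exp 1 * μ N)))
        (fun z _ => (hder n z).continuousAt.continuousWithinAt)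
        (fun z _ => (hder n z).hasDerivWithinAt) ?_ ?_ ?_
      · simpa using hx n
      · intro z
        have h0 : HasDerivAt (fun z => Real.exp 1 * μ N * (z - x)) (Real.exp 1 * μ N) z := by
          simpa using ((hasDerivAt_id z).sub_const x).const_mul (Real.exp 1 * μ N)
        exact h0.exp.const_mul _
      · intro z hz
        refine (ih (n + 1) (by omega) z (Set.Ico_subset_Icc_self hz)).trans ?_
        have hle : μ n ≤ μ N := hμ (by omega)
        have hexp : Real.exp ((n + 1 : ℕ) - (N + 1)) = Real.exp (n - (N + 1)) * Real.exp 1 := by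
          rw [← Real.exp_add]; congr 1; push_cast; ring
        rw [hexp, Finset.prod_range_succ]
        calc C * ((∏ j ∈ Finset.range n, μ j) * μ n) * (Real.exp (n - (N + 1)) * Real.exp 1) *
              Real.exp (Real.exp 1 * μ N * (z - x))
            = (C * (∏ j ∈ Finset.range n, μ j)) * (Real.exp (n - (N + 1)) *
              (Real.exp (Real.exp 1 * μ N * (z - x)) * Real.exp 1)) * μ n := by ring
          _ ≤ (C * (∏ j ∈ Finset.range n, μ j)) * (Real.exp (n - (N + 1)) *
              (Real.exp (Real.exp 1 * μ N * (z - x)) * Real.exp 1)) * μ N :=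
            mul_le_mul_of_nonneg_left hle (mul_nonneg (hM n) (by positivity))
          _ = _ := by ring
  intro n
  by_cases hn : n ≤ N
  · refine (key (N + 1 - n) n (by omega) y ⟨hxy, le_rfl⟩).trans ?_
    rw [mul_assoc, ← Real.exp_add]
    refine mul_le_mul_of_nonneg_left (Real.exp_le_exp.2 ?_) (hM n)
    -- The permitted distance makes the growth factor at most e, which is exactly one level.
    have hpos : 0 < Real.exp 1 * μ N := mul_pos (Real.exp_pos _) (hμ0 N)
    have := mul_le_mul_of_nonneg_left hd hpos.le
    rw [mul_one_div_cancel hpos.ne'] at this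
    linarith
  · refine (hb n y).trans (le_mul_of_one_le_right (hM n) (Real.one_le_exp ?_))
    have : (N : ℝ) ≤ n := by exact_mod_cast (not_le.1 hn).le
    linarith

/-- **Denjoy–Carleman theorem** (Bang's proof), for a sequence of functions each of which is the
derivative of the preceding one. -/
theorem eq_zero_of_bang {E : Type*} [NormedAddCommGroup E] [NormedSpace ℝ E] {g : ℕ → ℝ → E}
    {μ : ℕ → ℝ} {C : ℝ} (hμ0 : ∀ n, 0 < μ n) (hμ : Monotone μ) (hC : 0 ≤ C)
    (hsum : ¬ Summable fun n => 1 / μ n)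
    (hder : ∀ n t, HasDerivAt (g n) (g (n + 1) t) t)
    (hb : ∀ n t, ‖g n t‖ ≤ C * ∏ j ∈ Finset.range n, μ j) (h0 : ∀ n, g n 0 = 0)
    {t : ℝ} (ht : 0 ≤ t) : g 0 t = 0 := by
  have hM : ∀ n, 0 ≤ C * ∏ j ∈ Finset.range n, μ j := fun n =>
    mul_nonneg hC (Finset.prod_nonneg fun j _ => (hμ0 j).le)
  set δ : ℕ → ℝ := fun n => 1 / (Real.exp 1 * μ n) with hδ
  have hδ0 : ∀ n, 0 < δ n := fun n => by have := hμ0 n; positivity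
  have hδs : ¬ Summable δ := by
    intro h
    refine hsum ((h.mul_left (Real.exp 1)).congr fun n => ?_)
    have := (hμ0 n).ne'
    simp only [hδ]
    field_simp
  -- All derivatives vanish at 0, so closeness holds there at every level. Starting from level k + i
  -- and walking through steps δ (k+i-1), ..., δ k, one level is lost per step.
  have walk : ∀ i k : ℕ, ∀ x, 0 ≤ x → x ≤ ∑ j ∈ Finset.range i, δ (k + j) →
      ∀ n, ‖g n x‖ ≤ C * (∏ j ∈ Finset.range n, μ j) * Real.exp (n - k) := by
    intro i
    induction i with
    | zero =>
      intro k x hx hx' n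
      have : x = 0 := le_antisymm (by simpa using hx') hx
      rw [this, h0 n, norm_zero]
      exact mul_nonneg (hM n) (Real.exp_pos _).le
    | succ i ih =>
      intro k x hx hx'
      rw [Finset.sum_range_succ'] at hx'
      -- The previous point is truncated at 0, in case x lies within one step of the origin.
      have hx0 : 0 ≤ max 0 (x - δ k) := le_max_left _ _
      have hsm : 0 ≤ ∑ j ∈ Finset.range i, δ (k + 1 + j) :=
        Finset.sum_nonneg fun j _ => (hδ0 _).le
      have hre : ∑ j ∈ Finset.range i, δ (k + (j + 1)) = ∑ j ∈ Finset.range i, δ (k + 1 + j) :=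
        Finset.sum_congr rfl fun j _ => by congr 1; ring
      rw [hre, add_zero] at hx'
      have h1 := ih (k + 1) (max 0 (x - δ k)) hx0 (max_le hsm (by linarith))
      refine bang_step (x := max 0 (x - δ k)) (y := x) hμ0 hμ hC hder hb
        (max_le hx (by linarith [hδ0 k])) ?_ ?_
      · have := le_max_right 0 (x - δ k)
        change x - _ ≤ δ k
        linarith
      · intro n
        simpa using h1 n
  -- Every tail of Σ δ diverges, so t can be reached while still at level k, for any k.
  have hle : ∀ k : ℕ, ‖g 0 t‖ ≤ C * Real.exp (-k) := by
    intro k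
    have hs : ¬ Summable fun j => δ (k + j) := by
      intro h
      refine hδs ((summable_nat_add_iff k).1 (h.congr fun j => by rw [add_comm]))
    have htop := (not_summable_iff_tendsto_nat_atTop_of_nonneg fun j => (hδ0 _).le).1 hs
    obtain ⟨i, hi⟩ := (htop.eventually_ge_atTop t).exists
    simpa using walk i k t ht hi 0
  have hlim : Tendsto (fun k : ℕ => C * Real.exp (-(k : ℝ))) atTop (𝓝 (C * 0)) :=
    (Real.tendsto_exp_neg_atTop_nhds_zero.comp tendsto_natCast_atTop_atTop).const_mul C
  rw [mul_zero] at hlim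
  exact norm_le_zero_iff.1 (ge_of_tendsto' hlim hle)

/-! ### Moment bounds from the radial weight -/

/-- A bound of the moment weights `r ^ n * exp (-2 * θ r * r)` by a product of increasing
factors. -/
theorem exists_pow_mul_exp_le_prod {θ : ℝ → ℝ} (hanti : AntitoneOn θ (Set.Ici 0))
    (hlow : ∀ r, 0 ≤ r → 1 / √(1 + r) ≤ θ r) :
    ∃ C, 0 ≤ C ∧ ∀ r, 0 ≤ r → ∀ n : ℕ, r ^ n * Real.exp (-(2 * θ r * r)) ≤
      C * ∏ j ∈ Finset.range n, ((j + 1 : ℝ) / θ ((j + 1 : ℝ) ^ 4)) := by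
  set T := θ 0 with hT
  have hT1 : 1 ≤ T := by simpa using hlow 0 le_rfl
  refine ⟨Real.exp (1 + (T + 8) ^ 2 / 2), (Real.exp_pos _).le, fun r hr n => ?_⟩
  have hpos : ∀ s, 0 ≤ s → 0 < θ s := fun s hs =>
    lt_of_lt_of_le (by positivity) (hlow s hs)
  have ha := hpos r hr
  set D := T * √(1 + r) with hD
  have hs1 : 1 ≤ √(1 + r) := Real.one_le_sqrt.2 (by linarith)
  have hD1 : 1 ≤ D := one_le_mul_of_one_le_of_one_le hT1 hs1
  -- For n ≥ m one has r ≤ (n+1)^4, so monotonicity compares 1/θ(r) with the n-th factor directly.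
  -- Each of the m earlier factors costs D. The fourth power keeps m of order r^(1/4), so that D^m
  -- is dominated by exp(√r) and is absorbed by exp(-θ(r)r).
  set m := ⌊√√r⌋₊ with hm
  have hmr : (m : ℝ) ≤ √√r := Nat.floor_le (Real.sqrt_nonneg _)
  have hlt : ∀ n : ℕ, m ≤ n → r ≤ (n + 1 : ℝ) ^ 4 := by
    intro n hn
    have h1 : √√r ≤ n + 1 := (Nat.lt_floor_add_one _).le.trans (by
      have : (m : ℝ) ≤ n := by exact_mod_cast hn
      linarith)
    have h2 : (√√r) ^ 4 = r := by
      rw [show (√√r) ^ 4 = ((√√r) ^ 2) ^ 2 by ring, Real.sq_sqrt (Real.sqrt_nonneg _),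
        Real.sq_sqrt hr]
    rw [← h2]
    exact pow_le_pow_left₀ (Real.sqrt_nonneg _) h1 4
  have hind : ∀ n : ℕ, (1 / θ r) ^ n ≤
      D ^ (min n m) * ∏ j ∈ Finset.range n, (1 / θ ((j + 1 : ℝ) ^ 4)) := by
    intro n
    induction n with
    | zero => simp
    | succ n ih =>
      rw [pow_succ, Finset.prod_range_succ]
      have hp := hpos ((n + 1 : ℝ) ^ 4) (by positivity)
      have hP : 0 ≤ ∏ j ∈ Finset.range n, (1 / θ ((j + 1 : ℝ) ^ 4)) :=
        Finset.prod_nonneg fun j _ => (one_div_pos.2 (hpos _ (by positivity))).le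
      by_cases hnm : m ≤ n
      · have h1 : 1 / θ r ≤ 1 / θ ((n + 1 : ℝ) ^ 4) :=
          one_div_le_one_div_of_le hp (hanti hr (Set.mem_Ici.2 (by positivity)) (hlt n hnm))
        rw [min_eq_right (by omega)]
        rw [min_eq_right hnm] at ih
        rw [← mul_assoc]
        exact mul_le_mul ih h1 (one_div_pos.2 ha).le (mul_nonneg (by positivity) hP)
      · have h1 : 1 / θ r ≤ D * (1 / θ ((n + 1 : ℝ) ^ 4)) := by
          have h2 : 1 / θ r ≤ √(1 + r) := by
            rw [one_div]
            refine inv_le_of_inv_le₀ (by positivity) ?_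
            simpa using hlow r hr
          have h3 : 1 ≤ T * (1 / θ ((n + 1 : ℝ) ^ 4)) := by
            rw [mul_one_div, le_div_iff₀ hp, one_mul]
            exact hanti (Set.mem_Ici.2 le_rfl) (Set.mem_Ici.2 (by positivity)) (by positivity)
          calc 1 / θ r ≤ √(1 + r) * 1 := by simpa using h2
            _ ≤ √(1 + r) * (T * (1 / θ ((n + 1 : ℝ) ^ 4))) := by gcongr
            _ = _ := by rw [hD]; ring
        rw [min_eq_left (by omega), pow_succ]
        rw [min_eq_left (by omega)] at ih
        calc _ ≤ (D ^ n * ∏ j ∈ Finset.range n, (1 / θ ((j + 1 : ℝ) ^ 4))) *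
              (D * (1 / θ ((n + 1 : ℝ) ^ 4))) :=
              mul_le_mul ih h1 (one_div_pos.2 ha).le (mul_nonneg (by positivity) hP)
          _ = _ := by ring
  have hP : 0 ≤ ∏ j ∈ Finset.range n, (1 / θ ((j + 1 : ℝ) ^ 4)) :=
    Finset.prod_nonneg fun j _ => (one_div_pos.2 (hpos _ (by positivity))).le
  have hfac : r ^ n * Real.exp (-(θ r * r)) ≤ n.factorial * (1 / θ r) ^ n := by
    have h := Real.pow_div_factorial_le_exp (θ r * r) (by positivity) n
    rw [div_le_iff₀ (by positivity), mul_pow] at h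
    rw [Real.exp_neg, ← div_eq_mul_inv, div_le_iff₀ (Real.exp_pos _), one_div, inv_pow]
    have : r ^ n = (θ r ^ n)⁻¹ * (θ r ^ n * r ^ n) := by
      rw [← mul_assoc, inv_mul_cancel₀ (by positivity), one_mul]
    rw [this]
    calc _ ≤ (θ r ^ n)⁻¹ * (Real.exp (θ r * r) * n.factorial) := by gcongr
      _ = _ := by ring
  -- With v = (1+r)^(1/8) the exponent is at most v²(T+4v) - v⁴ + 1. Here 4v³ ≤ v⁴/2 + 8v², and
  -- (T+8)v² - v⁴/2 ≤ (T+8)²/2, which gives the constant.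
  have hDm : D ^ m * Real.exp (-(θ r * r)) ≤ Real.exp (1 + (T + 8) ^ 2 / 2) := by
    set u := √√(1 + r) with hu
    have hu1 : 1 ≤ u := Real.one_le_sqrt.2 hs1
    have huu : u ^ 2 = √(1 + r) := Real.sq_sqrt (Real.sqrt_nonneg _)
    set v := √u with hv
    have hv1 : 1 ≤ v := Real.one_le_sqrt.2 hu1
    have hvv : v ^ 2 = u := Real.sq_sqrt (by linarith)
    have hv4 : v ^ 4 = √(1 + r) := by rw [← huu, ← hvv]; ring
    have hmv : (m : ℝ) ≤ v ^ 2 := by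
      rw [hvv]
      exact hmr.trans (Real.sqrt_le_sqrt (Real.sqrt_le_sqrt (by linarith)))
    have hlogD : Real.log D ≤ T + 4 * v := by
      rw [hD, ← hv4, Real.log_mul (by linarith) (by positivity), Real.log_pow]
      have h1 := Real.log_le_sub_one_of_pos (show 0 < T by linarith)
      have h2 := Real.log_le_sub_one_of_pos (show 0 < v by linarith)
      push_cast
      linarith
    have har : v ^ 4 - 1 ≤ θ r * r := by
      have h1 : 1 / √(1 + r) * r ≤ θ r * r := mul_le_mul_of_nonneg_right (hlow r hr) hr
      refine le_trans ?_ h1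
      rw [hv4, one_div_mul_eq_div, le_div_iff₀ (by positivity), sub_mul,
        Real.mul_self_sqrt (by linarith)]
      linarith
    rw [← Real.exp_log (show 0 < D by linarith), ← Real.exp_nat_mul, ← Real.exp_add,
      Real.exp_le_exp]
    have h1 : (m : ℝ) * Real.log D ≤ v ^ 2 * (T + 4 * v) :=
      mul_le_mul hmv hlogD (Real.log_nonneg hD1) (by positivity)
    nlinarith [mul_nonneg (sq_nonneg v) (sq_nonneg (v - 4)), sq_nonneg (v ^ 2 - (T + 8))]
  -- The weight is split in two: one factor exp(-θ(r)r) controls r^n by a factorial, the other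
  -- absorbs D^m.
  calc r ^ n * Real.exp (-(2 * θ r * r))
      = (r ^ n * Real.exp (-(θ r * r))) * Real.exp (-(θ r * r)) := by
        rw [mul_assoc (r ^ n), ← Real.exp_add]; congr 2; ring
    _ ≤ (n.factorial * (1 / θ r) ^ n) * Real.exp (-(θ r * r)) := by gcongr
    _ ≤ (n.factorial * (D ^ (min n m) * ∏ j ∈ Finset.range n, (1 / θ ((j + 1 : ℝ) ^ 4)))) *
        Real.exp (-(θ r * r)) := by gcongr; exact hind n
    _ ≤ (n.factorial * (D ^ m * ∏ j ∈ Finset.range n, (1 / θ ((j + 1 : ℝ) ^ 4)))) *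
        Real.exp (-(θ r * r)) := by
        gcongr
        exact min_le_right _ _
    _ = (D ^ m * Real.exp (-(θ r * r))) *
        (n.factorial * ∏ j ∈ Finset.range n, (1 / θ ((j + 1 : ℝ) ^ 4))) := by ring
    _ ≤ Real.exp (1 + (T + 8) ^ 2 / 2) *
        (n.factorial * ∏ j ∈ Finset.range n, (1 / θ ((j + 1 : ℝ) ^ 4))) := by gcongr
    _ = _ := by
      congr 1
      rw [← Finset.prod_range_add_one_eq_factorial, Nat.cast_prod, ← Finset.prod_mul_distrib]
      exact Finset.prod_congr rfl fun j _ => by push_cast; ring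

/-! ### The integral I as a series over the radial profile -/

/-- The profile is θ along a coordinate axis, which needs d ≠ 0. Its values at negative r are still
values of θ, so nonnegativity of θ passes to all r although monotonicity is claimed only for r ≥ 0.
-/
theorem RadiallyDecreasing.exists_profile {d : ℕ} (hd : d ≠ 0) {θ : Rd d → ℝ}
    (h : RadiallyDecreasing θ) :
    ∃ φ : ℝ → ℝ, (∀ r, ∃ ξ, φ r = θ ξ) ∧ AntitoneOn φ (Set.Ici 0) ∧ ∀ ξ, θ ξ = φ ‖ξ‖ := by
  have : NeZero d := ⟨hd⟩
  refine ⟨fun r => θ (EuclideanSpace.single 0 r), fun r => ⟨_, rfl⟩, ?_, fun ξ => ?_⟩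
  · intro a ha b hb hab
    refine h _ _ ?_
    simpa [abs_of_nonneg (Set.mem_Ici.1 ha), abs_of_nonneg (Set.mem_Ici.1 hb)] using hab
  · exact le_antisymm (h _ _ (by simp)) (h _ _ (by simp))

/-- The spherical shells between consecutive powers of `b`. -/
def powShell (d b k : ℕ) : Set (Rd d) :=
  Metric.ball 0 ((b : ℝ) ^ (k + 1)) \ Metric.ball 0 ((b : ℝ) ^ k)

theorem mem_powShell {d b k : ℕ} {ξ : Rd d} :
    ξ ∈ powShell d b k ↔ (b : ℝ) ^ k ≤ ‖ξ‖ ∧ ‖ξ‖ < (b : ℝ) ^ (k + 1) := by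
  simp [powShell, and_comm]

theorem measurableSet_powShell (d b k : ℕ) : MeasurableSet (powShell d b k) :=
  measurableSet_ball.diff measurableSet_ball

theorem iUnion_powShell (d : ℕ) {b : ℕ} (hb : 2 ≤ b) :
    ⋃ k, powShell d b k = {ξ : Rd d | 1 ≤ ‖ξ‖} := by
  have hb1 : (1 : ℝ) < b := by exact_mod_cast hb
  ext ξ
  simp only [Set.mem_iUnion, mem_powShell, Set.mem_ofPred_eq]
  constructor
  · rintro ⟨k, hk, -⟩
    exact (one_le_pow₀ hb1.le).trans hk
  · exact fun h => exists_nat_pow_near h hb1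

theorem pairwise_disjoint_powShell (d : ℕ) {b : ℕ} (hb : 2 ≤ b) :
    Pairwise (Function.onFun Disjoint (powShell d b)) := by
  have hb1 : (1 : ℝ) ≤ b := by exact_mod_cast (by omega : 1 ≤ b)
  have key : ∀ i j : ℕ, i < j → Disjoint (powShell d b i) (powShell d b j) := by
    intro i j hij
    refine Set.disjoint_left.2 fun ξ h1 h2 => ?_
    rw [mem_powShell] at h1 h2
    exact absurd (h2.1.trans_lt h1.2) (not_lt.2 (pow_le_pow_right₀ hb1 hij))
  intro i j hij
  rcases lt_or_gt_of_ne hij with h | h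
  · exact key i j h
  · exact (key j i h).symm

theorem inghamIntegral_eq_tsum {d : ℕ} (θ : Rd d → ℝ) {b : ℕ} (hb : 2 ≤ b) :
    inghamIntegral θ = ∑' k, ∫⁻ ξ in powShell d b k, ENNReal.ofReal (θ ξ / ‖ξ‖ ^ d) := by
  rw [inghamIntegral, ← iUnion_powShell d hb,
    lintegral_iUnion (measurableSet_powShell d b) (pairwise_disjoint_powShell d hb)]

theorem volume_ball_pow (d : ℕ) {b : ℕ} (hb : 0 < b) (k : ℕ) : volume (Metric.ball (0 : Rd d) ((b : ℝ) ^ k)) =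
    ENNReal.ofReal ((b : ℝ) ^ (k * d)) * volume (Metric.ball (0 : Rd d) 1) := by
  have hb0 : (0 : ℝ) < b := by exact_mod_cast hb
  rw [Measure.addHaar_ball_of_pos _ _ (by positivity), finrank_euclideanSpace_fin, pow_mul]

/-- The k-th shell has volume at most a constant times b^(kd), which cancels ‖ξ‖^d; by monotonicity
it contributes at most a constant times φ(b^k). -/
theorem inghamIntegral_lt_top_of_summable {d : ℕ} {θ : Rd d → ℝ} {φ : ℝ → ℝ}
    (hφ : AntitoneOn φ (Set.Ici 0)) (hθ : ∀ ξ, θ ξ = φ ‖ξ‖) {b : ℕ} (hb : 2 ≤ b)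
    (hs : Summable fun k : ℕ => φ ((b : ℝ) ^ k)) (hφ0 : ∀ r, 0 ≤ φ r) : inghamIntegral θ < ⊤ := by
  have hb0 : (0 : ℝ) < b := by exact_mod_cast (by omega : 0 < b)
  set V := volume (Metric.ball (0 : Rd d) 1)
  have hV : V < ⊤ := measure_ball_lt_top
  rw [inghamIntegral_eq_tsum θ hb]
  have hle : ∀ k, ∫⁻ ξ in powShell d b k, ENNReal.ofReal (θ ξ / ‖ξ‖ ^ d) ≤
      ENNReal.ofReal (φ ((b : ℝ) ^ k)) * (ENNReal.ofReal ((b : ℝ) ^ d) * V) := by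
    intro k
    calc ∫⁻ ξ in powShell d b k, ENNReal.ofReal (θ ξ / ‖ξ‖ ^ d)
        ≤ ∫⁻ ξ in powShell d b k, ENNReal.ofReal (φ ((b : ℝ) ^ k) / ((b : ℝ) ^ k) ^ d) := by
          refine setLIntegral_mono' (measurableSet_powShell d b k) fun ξ hξ => ?_
          rw [mem_powShell] at hξ
          refine ENNReal.ofReal_le_ofReal ?_
          rw [hθ]
          refine div_le_div₀ (hφ0 _) (hφ (Set.mem_Ici.2 (by positivity))
            (Set.mem_Ici.2 (norm_nonneg _)) hξ.1) (by positivity)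
            (pow_le_pow_left₀ (by positivity) hξ.1 d)
      _ = ENNReal.ofReal (φ ((b : ℝ) ^ k) / ((b : ℝ) ^ k) ^ d) * volume (powShell d b k) :=
          setLIntegral_const _ _
      _ ≤ ENNReal.ofReal (φ ((b : ℝ) ^ k) / ((b : ℝ) ^ k) ^ d) *
            (ENNReal.ofReal ((b : ℝ) ^ ((k + 1) * d)) * V) := by
          gcongr
          rw [← volume_ball_pow d (by omega)]
          exact measure_mono Set.sdiff_subset
      _ = _ := by
          rw [← mul_assoc, ← mul_assoc, ← ENNReal.ofReal_mul (div_nonneg (hφ0 _) (by positivity)),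
            ← ENNReal.ofReal_mul (hφ0 _)]
          congr 2
          rw [← pow_mul, add_mul, pow_add, one_mul]
          field_simp
  refine (ENNReal.tsum_le_tsum hle).trans_lt ?_
  rw [ENNReal.tsum_mul_right]
  refine ENNReal.mul_lt_top ?_ (ENNReal.mul_lt_top ENNReal.ofReal_lt_top hV)
  rw [← ENNReal.ofReal_tsum_of_nonneg (fun _ => hφ0 _) hs]
  exact ENNReal.ofReal_lt_top

theorem summable_of_inghamIntegral_lt_top {d : ℕ} (hd : d ≠ 0) {θ : Rd d → ℝ} {φ : ℝ → ℝ}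
    (hφ : AntitoneOn φ (Set.Ici 0)) (hθ : ∀ ξ, θ ξ = φ ‖ξ‖) {b : ℕ} (hb : 2 ≤ b)
    (hφ0 : ∀ r, 0 ≤ φ r) (hI : inghamIntegral θ < ⊤) :
    Summable fun k : ℕ => φ ((b : ℝ) ^ k) := by
  have hb0 : (0 : ℝ) < b := by exact_mod_cast (by omega : 0 < b)
  set V := volume (Metric.ball (0 : Rd d) 1) with hVdef
  have hV : V ≠ 0 := (Metric.measure_ball_pos _ _ one_pos).ne'
  have hV' : V ≠ ⊤ := measure_ball_lt_top.ne
  rw [inghamIntegral_eq_tsum θ hb] at hI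
  have hle : ∀ k, ENNReal.ofReal (φ ((b : ℝ) ^ (k + 1))) * (ENNReal.ofReal (1 / (b : ℝ) ^ d) * V) ≤
      ∫⁻ ξ in powShell d b k, ENNReal.ofReal (θ ξ / ‖ξ‖ ^ d) := by
    intro k
    calc ENNReal.ofReal (φ ((b : ℝ) ^ (k + 1))) * (ENNReal.ofReal (1 / (b : ℝ) ^ d) * V)
        = ENNReal.ofReal (φ ((b : ℝ) ^ (k + 1)) / ((b : ℝ) ^ (k + 1)) ^ d) *
            (ENNReal.ofReal ((b : ℝ) ^ (k * d)) * V) := by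
          rw [← mul_assoc, ← mul_assoc, ← ENNReal.ofReal_mul (div_nonneg (hφ0 _) (by positivity)),
            ← ENNReal.ofReal_mul (hφ0 _)]
          congr 2
          rw [← pow_mul, add_mul, pow_add, one_mul]
          field_simp
          ring
      _ ≤ ENNReal.ofReal (φ ((b : ℝ) ^ (k + 1)) / ((b : ℝ) ^ (k + 1)) ^ d) *
            volume (powShell d b k) := by
          gcongr
          rw [powShell, measure_sdiff (Metric.ball_subset_ball (pow_le_pow_right₀
            (by exact_mod_cast (by omega : 1 ≤ b)) (Nat.le_succ k)))
            measurableSet_ball.nullMeasurableSet measure_ball_lt_top.ne,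
            volume_ball_pow d (by omega), volume_ball_pow d (by omega), ← hVdef,
            ← ENNReal.sub_mul (fun _ _ => hV'), ← ENNReal.ofReal_sub _ (by positivity)]
          gcongr
          rw [Nat.succ_mul, pow_add]
          -- The shell has volume (b^d - 1) b^(kd) V, and b^d ≥ 2 since d ≠ 0.
          have h2 : (2 : ℝ) ≤ (b : ℝ) ^ d := by
            have h2b : (2 : ℝ) ≤ b := by exact_mod_cast hb
            exact h2b.trans (le_self_pow₀ (by linarith) hd)
          nlinarith [show 0 < (b : ℝ) ^ (k * d) by positivity]
      _ = ∫⁻ ξ in powShell d b k,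
            ENNReal.ofReal (φ ((b : ℝ) ^ (k + 1)) / ((b : ℝ) ^ (k + 1)) ^ d) :=
          (setLIntegral_const _ _).symm
      _ ≤ _ := by
          refine setLIntegral_mono' (measurableSet_powShell d b k) fun ξ hξ => ?_
          rw [mem_powShell] at hξ
          refine ENNReal.ofReal_le_ofReal ?_
          rw [hθ]
          have hpos : 0 < ‖ξ‖ := lt_of_lt_of_le (by positivity) hξ.1
          exact div_le_div₀ (hφ0 _) (hφ (Set.mem_Ici.2 (norm_nonneg _))
            (Set.mem_Ici.2 (by positivity)) hξ.2.le) (by positivity)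
            (pow_le_pow_left₀ (norm_nonneg _) hξ.2.le d)
  have h1 := (ENNReal.tsum_le_tsum hle).trans_lt hI
  rw [ENNReal.tsum_mul_right] at h1
  have h2 : ∑' k : ℕ, ENNReal.ofReal (φ ((b : ℝ) ^ (k + 1))) ≠ ⊤ := by
    intro h
    rw [h, ENNReal.top_mul] at h1
    · exact lt_irrefl _ h1
    · refine mul_ne_zero ?_ hV
      rw [Ne, ENNReal.ofReal_eq_zero, not_le]
      positivity
  have h3 := ENNReal.summable_toReal h2
  rw [← summable_nat_add_iff 1]
  exact h3.congr fun k => ENNReal.toReal_ofReal (hφ0 _)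

/-- Cauchy condensation: 2^k times the term at n = 2^k is φ((2^p)^k). The term n = 0 is 0 by the
convention for division by zero. -/
theorem summable_div_of_summable_pow {φ : ℝ → ℝ} (hφ : AntitoneOn φ (Set.Ici 0))
    (hφ0 : ∀ r, 0 ≤ φ r) (p : ℕ) :
    (Summable fun k : ℕ => φ (((2 ^ p : ℕ) : ℝ) ^ k)) ↔
      Summable fun n : ℕ => φ ((n : ℝ) ^ p) / n := by
  rw [← summable_condensed_iff_of_nonneg (f := fun n : ℕ => φ ((n : ℝ) ^ p) / n)]
  · refine summable_congr fun k => ?_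
    have : ((2 : ℝ) ^ k) ≠ 0 := by positivity
    push_cast
    rw [mul_div_cancel₀ _ this]
    congr 1
    ring
  · exact fun n => div_nonneg (hφ0 _) (Nat.cast_nonneg n)
  · intro m n hm hmn
    have hm' : (0 : ℝ) < m := by exact_mod_cast hm
    have hmn' : (m : ℝ) ≤ n := by exact_mod_cast hmn
    exact div_le_div₀ (hφ0 _) (hφ (Set.mem_Ici.2 (by positivity)) (Set.mem_Ici.2 (by positivity))
      (pow_le_pow_left₀ hm'.le hmn' p)) hm' hmn'

/-! ### Ingham's infinite convolution -/

/-- A Schwartz function `Ψ` all of whose dilates are Fourier transforms of smooth functions of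
small support. -/
theorem exists_dilation_bump (d : ℕ) : ∃ Ψ : 𝓢(Rd d, ℂ), Ψ 0 = 1 ∧ (∀ ξ, ‖Ψ ξ‖ ≤ 1) ∧
    ∀ ρ : ℝ, 0 < ρ → ∃ u : 𝓢(Rd d, ℂ), (∀ x, ρ ≤ ‖x‖ → u x = 0) ∧
      ∀ ξ, 𝓕 (u : Rd d → ℂ) ξ = Ψ (ρ • ξ) := by
  let φ : ContDiffBump (0 : Rd d) := ⟨1 / 2, 1, by norm_num, by norm_num⟩
  let w : Rd d → ℝ := φ.normed volume
  have hw : ContDiff ℝ ∞ w := φ.contDiff_normed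
  have hws : ∀ x, 1 ≤ ‖x‖ → w x = 0 := by
    intro x hx
    have : x ∉ Function.support w := by
      rw [show Function.support w = Metric.ball 0 1 from φ.support_normed_eq]
      simpa using hx
    simpa using this
  have hw0 : ∀ x, 0 ≤ w x := fun x => φ.nonneg_normed x
  have hw1 : ∫ x, w x = 1 := φ.integral_normed
  have hsm : ∀ ρ : ℝ, 0 < ρ → ∃ u : 𝓢(Rd d, ℂ), ∀ x, u x = ((ρ ^ d)⁻¹ * w (ρ⁻¹ • x) : ℝ) := by
    intro ρ hρ
    have h1 : ContDiff ℝ ∞ fun x => (((ρ ^ d)⁻¹ * w (ρ⁻¹ • x) : ℝ) : ℂ) := by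
      refine Complex.ofRealCLM.contDiff.comp ?_
      exact contDiff_const.mul (hw.comp (contDiff_const_smul _))
    have h2 : HasCompactSupport fun x => (((ρ ^ d)⁻¹ * w (ρ⁻¹ • x) : ℝ) : ℂ) := by
      refine HasCompactSupport.intro (isCompact_closedBall (0 : Rd d) ρ) fun x hx => ?_
      rw [mem_closedBall_zero_iff, not_le] at hx
      rw [hws, mul_zero, Complex.ofReal_zero]
      rw [norm_smul, norm_inv, Real.norm_of_nonneg hρ.le, inv_mul_eq_div, le_div_iff₀ hρ]
      linarith
    exact ⟨h2.toSchwartzMap h1, fun x => rfl⟩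
  obtain ⟨ψ, hψ⟩ := hsm 1 one_pos
  have hψ' : ∀ x, ψ x = (w x : ℂ) := fun x => by simp [hψ]
  refine ⟨𝓕 ψ, ?_, ?_, ?_⟩
  · rw [SchwartzMap.fourier_coe, Real.fourier_eq]
    simp only [inner_zero_right, neg_zero, AddChar.map_zero_eq_one, one_smul, hψ']
    rw [integral_complex_ofReal, hw1, Complex.ofReal_one]
  · intro ξ
    rw [SchwartzMap.fourier_coe, Real.fourier_eq]
    refine (norm_integral_le_integral_norm _).trans ?_
    rw [← hw1]
    refine le_of_eq (integral_congr_ae (Eventually.of_forall fun x => ?_))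
    simp only [Circle.norm_smul, hψ', Complex.norm_real, Real.norm_of_nonneg (hw0 x)]
  · intro ρ hρ
    obtain ⟨u, hu⟩ := hsm ρ hρ
    refine ⟨u, fun x hx => ?_, fun ξ => ?_⟩
    · rw [hu, hws, mul_zero, Complex.ofReal_zero]
      rw [norm_smul, norm_inv, Real.norm_of_nonneg hρ.le, inv_mul_eq_div, le_div_iff₀ hρ]
      linarith
    · rw [SchwartzMap.fourier_coe, Real.fourier_eq, Real.fourier_eq]
      set G : Rd d → ℂ := fun y => Real.fourierChar (-inner ℝ y (ρ • ξ)) • ψ y with hG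
      have h1 : ∀ x : Rd d, Real.fourierChar (-inner ℝ x ξ) • u x =
          ((ρ ^ d)⁻¹ : ℂ) • G (ρ⁻¹ • x) := by
        intro x
        have h2 : inner ℝ (ρ⁻¹ • x) (ρ • ξ) = inner ℝ x ξ := by
          rw [real_inner_smul_left, real_inner_smul_right, inv_mul_cancel_left₀ hρ.ne']
        simp only [hG, h2, hu, hψ', Circle.smul_def, smul_eq_mul]
        push_cast
        ring
      simp_rw [h1]
      rw [integral_smul, Measure.integral_comp_inv_smul volume G ρ, finrank_euclideanSpace_fin,
        abs_of_pos (by positivity), Complex.real_smul, smul_eq_mul, ← mul_assoc]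
      push_cast
      rw [inv_mul_cancel₀, one_mul]
      exact pow_ne_zero _ (by exact_mod_cast hρ.ne')

theorem exists_schwartz_fourier_prod {d : ℕ} {Ψ : 𝓢(Rd d, ℂ)}
    (hΨ : ∀ ρ : ℝ, 0 < ρ → ∃ u : 𝓢(Rd d, ℂ), (∀ x, ρ ≤ ‖x‖ → u x = 0) ∧
      ∀ ξ, 𝓕 (u : Rd d → ℂ) ξ = Ψ (ρ • ξ)) {ρ : ℕ → ℝ} (hρ : ∀ n, 0 < ρ n) (n : ℕ) :
    ∃ f : 𝓢(Rd d, ℂ), (∀ x, ∑ j ∈ Finset.range (n + 1), ρ j ≤ ‖x‖ → f x = 0) ∧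
      ∀ ξ, 𝓕 (f : Rd d → ℂ) ξ = ∏ j ∈ Finset.range (n + 1), Ψ (ρ j • ξ) := by
  induction n with
  | zero => simpa using hΨ (ρ 0) (hρ 0)
  | succ n ih =>
    obtain ⟨f, hf, hf'⟩ := ih
    obtain ⟨u, hu, hu'⟩ := hΨ (ρ (n + 1)) (hρ (n + 1))
    refine ⟨SchwartzMap.convolution (ContinuousLinearMap.mul ℂ ℂ) f u, fun x hx => ?_,
      fun ξ => ?_⟩
    · rw [SchwartzMap.convolution_apply, convolution_def]
      refine integral_eq_zero_of_ae (Eventually.of_forall fun t => ?_)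
      rw [Finset.sum_range_succ] at hx
      simp only [ContinuousLinearMap.mul_apply', Pi.zero_apply, mul_eq_zero]
      by_contra! h
      have h1 : ‖t‖ < _ := not_le.1 fun h' => h.1 (hf t h')
      have h2 : ‖x - t‖ < _ := not_le.1 fun h' => h.2 (hu _ h')
      have h3 : ‖x‖ ≤ ‖t‖ + ‖x - t‖ := by simpa using norm_add_le t (x - t)
      linarith
    · rw [← SchwartzMap.fourier_coe, SchwartzMap.fourier_convolution_apply,
        Real.fourier_mul_convolution_eq f.integrable u.integrable, hf', hu',
        Finset.prod_range_succ _ (n + 1)]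

/-- An infinite convolution of dilated bump functions is a smooth function of compact support. -/
theorem exists_contDiff_fourier_le_prod {d : ℕ} {Ψ : 𝓢(Rd d, ℂ)} (hΨ0 : Ψ 0 = 1)
    (hΨ1 : ∀ ξ, ‖Ψ ξ‖ ≤ 1)
    (hΨ : ∀ ρ : ℝ, 0 < ρ → ∃ u : 𝓢(Rd d, ℂ), (∀ x, ρ ≤ ‖x‖ → u x = 0) ∧
      ∀ ξ, 𝓕 (u : Rd d → ℂ) ξ = Ψ (ρ • ξ)) {ρ : ℕ → ℝ} (hρ : ∀ n, 0 < ρ n) (hs : Summable ρ) :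
    ∃ f : Rd d → ℂ, ContDiff ℝ ∞ f ∧ (∀ x, ∑' j, ρ j ≤ ‖x‖ → f x = 0) ∧ 𝓕 f 0 = 1 ∧
      ∀ m ξ, ‖𝓕 f ξ‖ ≤ ∏ j ∈ Finset.range m, ‖Ψ (ρ j • ξ)‖ := by
  choose F hF hF' using exists_schwartz_fourier_prod hΨ hρ
  -- Ψ is Lipschitz with Ψ(0) = 1, so summability of ρ makes the infinite product converge at every
  -- ξ.
  obtain ⟨L, hL⟩ : ∃ L, ∀ ξ, ‖Ψ ξ - 1‖ ≤ L * ‖ξ‖ := by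
    refine ⟨SchwartzMap.seminorm ℝ 0 1 Ψ, fun ξ => ?_⟩
    have := Convex.norm_image_sub_le_of_norm_fderiv_le (𝕜 := ℝ) (f := Ψ) (s := Set.univ)
      (C := SchwartzMap.seminorm ℝ 0 1 Ψ) (x := 0) (y := ξ)
      (fun x _ => Ψ.differentiableAt) (fun x _ => by
        have := Ψ.norm_iteratedFDeriv_le_seminorm ℝ 1 x
        rwa [norm_iteratedFDeriv_one] at this) convex_univ trivial trivial
    simpa [hΨ0] using this
  set Φ : Rd d → ℂ := fun ξ => ∏' j, Ψ (ρ j • ξ) with hΦ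
  have hlim : ∀ ξ, Tendsto (fun n => ∏ j ∈ Finset.range n, Ψ (ρ j • ξ)) atTop (𝓝 (Φ ξ)) := by
    intro ξ
    have h1 : Summable fun j => Ψ (ρ j • ξ) - 1 := by
      refine Summable.of_norm_bounded ((hs.mul_right ‖ξ‖).mul_left L) fun j => ?_
      refine (hL _).trans_eq ?_
      rw [norm_smul, Real.norm_of_nonneg (hρ j).le]
    have h2 := Complex.multipliable_one_add_of_summable h1
    simp only [add_sub_cancel] at h2
    exact h2.hasProd.tendsto_prod_nat
  have hle : ∀ m n, m ≤ n → ∀ ξ, ‖∏ j ∈ Finset.range n, Ψ (ρ j • ξ)‖ ≤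
      ∏ j ∈ Finset.range m, ‖Ψ (ρ j • ξ)‖ := by
    intro m n hmn ξ
    rw [norm_prod]
    rw [← Finset.prod_range_mul_prod_Ico _ hmn]
    exact mul_le_of_le_one_right (Finset.prod_nonneg fun _ _ => norm_nonneg _)
      (Finset.prod_le_one (fun _ _ => norm_nonneg _) fun _ _ => hΨ1 _)
  have hΦle : ∀ m ξ, ‖Φ ξ‖ ≤ ∏ j ∈ Finset.range m, ‖Ψ (ρ j • ξ)‖ := fun m ξ =>
    le_of_tendsto (hlim ξ).norm ((eventually_ge_atTop m).mono fun n hn => hle m n hn ξ)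
  have hF0 : ∀ ξ, ‖(𝓕 (F 0)) ξ‖ = ∏ j ∈ Finset.range 1, ‖Ψ (ρ j • ξ)‖ := by
    intro ξ
    rw [SchwartzMap.fourier_coe, hF', norm_prod]
  have hFle : ∀ n ξ, ‖(𝓕 (F n)) ξ‖ ≤ ‖(𝓕 (F 0)) ξ‖ := by
    intro n ξ
    rw [hF0, SchwartzMap.fourier_coe, hF']
    exact hle 1 (n + 1) (by omega) ξ
  have hFlim : ∀ ξ, Tendsto (fun n => (𝓕 (F n)) ξ) atTop (𝓝 (Φ ξ)) := by
    intro ξ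
    simp only [SchwartzMap.fourier_coe, hF']
    exact (hlim ξ).comp (tendsto_add_atTop_nat 1)
  have hΦm : AEStronglyMeasurable Φ volume :=
    aestronglyMeasurable_of_tendsto_ae atTop
      (fun n => (𝓕 (F n)).continuous.aestronglyMeasurable) (Eventually.of_forall hFlim)
  have hΦF0 : ∀ ξ, ‖Φ ξ‖ ≤ ‖(𝓕 (F 0)) ξ‖ := fun ξ => by rw [hF0]; exact hΦle 1 ξ
  -- All transforms are dominated by that of `F 0`, a Schwartz function, so Fourier inversion for `F
  -- n` passes to the limit.
  have hpt : ∀ x, Tendsto (fun n => F n x) atTop (𝓝 (𝓕⁻ Φ x)) := by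
    intro x
    have h1 : ∀ n, F n x = ∫ v, Real.fourierChar (inner ℝ v x) • (𝓕 (F n)) v := by
      intro n
      rw [← Real.fourierInv_eq, ← SchwartzMap.fourierInv_coe, FourierTransform.fourierInv_fourier_eq]
    simp_rw [h1, Real.fourierInv_eq]
    refine tendsto_integral_of_dominated_convergence (fun v => ‖(𝓕 (F 0)) v‖) (fun n => ?_)
      (𝓕 (F 0)).integrable.norm (fun n => Eventually.of_forall fun v => ?_)
      (Eventually.of_forall fun v => (hFlim v).const_smul _)
    · refine Continuous.aestronglyMeasurable ?_
      have := (𝓕 (F n)).continuous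
      fun_prop
    · rw [Circle.norm_smul]
      exact hFle n v
  have hR : ∀ n x, ∑' j, ρ j ≤ ‖x‖ → F n x = 0 := fun n x hx =>
    hF n x ((hs.sum_le_tsum _ fun j _ => (hρ j).le).trans hx)
  have hbound : ∀ n x, ‖F n x‖ ≤ ∫ v, ‖(𝓕 (F 0)) v‖ := by
    intro n x
    have h1 : F n x = ∫ v, Real.fourierChar (inner ℝ v x) • (𝓕 (F n)) v := by
      rw [← Real.fourierInv_eq, ← SchwartzMap.fourierInv_coe, FourierTransform.fourierInv_fourier_eq]
    rw [h1]
    refine (norm_integral_le_integral_norm _).trans ?_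
    simp_rw [Circle.norm_smul]
    exact integral_mono (𝓕 (F n)).integrable.norm (𝓕 (F 0)).integrable.norm (hFle n)
  -- A second dominated convergence, now in x: the `F n` are uniformly bounded and vanish outside a
  -- common ball.
  have hfour : 𝓕 (𝓕⁻ Φ) = Φ := by
    funext ξ
    refine tendsto_nhds_unique (f := fun n => (𝓕 (F n)) ξ) ?_ (hFlim ξ)
    simp only [SchwartzMap.fourier_coe, Real.fourier_eq]
    refine tendsto_integral_of_dominated_convergence
      ((Metric.closedBall (0 : Rd d) (∑' j, ρ j)).indicator fun _ => ∫ v, ‖(𝓕 (F 0)) v‖)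
      (fun n => ?_) ?_ (fun n => Eventually.of_forall fun v => ?_)
      (Eventually.of_forall fun v => (hpt v).const_smul _)
    · refine Continuous.aestronglyMeasurable ?_
      have := (F n).continuous
      fun_prop
    · rw [integrable_indicator_iff Metric.isClosed_closedBall.measurableSet]
      exact integrableOn_const measure_closedBall_lt_top.ne
    · rw [Circle.norm_smul]
      by_cases hv : v ∈ Metric.closedBall (0 : Rd d) (∑' j, ρ j)
      · rw [Set.indicator_of_mem hv]
        exact hbound n v
      · rw [Set.indicator_of_notMem hv, hR n v, norm_zero]
        rw [mem_closedBall_zero_iff, not_le] at hv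
        exact hv.le
  refine ⟨𝓕⁻ Φ, ?_, fun x hx => ?_, ?_, ?_⟩
  · have h1 : ContDiff ℝ ∞ (𝓕 Φ) := by
      refine Real.contDiff_fourier fun n _ => ?_
      refine ((𝓕 (F 0)).integrable_pow_mul volume n).mono
        ((continuous_norm.pow n).aestronglyMeasurable.mul hΦm.norm)
        (Eventually.of_forall fun v => ?_)
      rw [norm_mul, norm_mul, norm_norm, norm_norm]
      exact mul_le_mul_of_nonneg_left (hΦF0 v) (norm_nonneg _)
    have h2 : 𝓕⁻ Φ = fun x => 𝓕 Φ (-x) := by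
      funext x
      rw [Real.fourierInv_eq_fourier_neg]
    rw [h2]
    exact h1.comp contDiff_neg
  · refine tendsto_nhds_unique (hpt x) ?_
    simp only [hR _ x hx]
    exact tendsto_const_nhds
  · rw [hfour]
    simp [hΦ, hΨ0]
  · rw [hfour]
    exact hΦle

/-- **Ingham's construction**: a smooth function of small support whose Fourier transform decays
like `exp (-φ ‖ξ‖ * ‖ξ‖)`. -/
theorem exists_contDiff_fourier_le_exp (d : ℕ) {φ : ℝ → ℝ} (hφ : AntitoneOn φ (Set.Ici 0))
    (hφ0 : ∀ r, 0 ≤ r → 0 < φ r) (hφ1 : ∃ R, 0 ≤ R ∧ φ R ≤ 1)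
    (hs : Summable fun n : ℕ => φ n / n) {ε : ℝ} (hε : 0 < ε) :
    ∃ f : Rd d → ℂ, ContDiff ℝ ∞ f ∧ (∀ x, ε ≤ ‖x‖ → f x = 0) ∧ 𝓕 f 0 = 1 ∧
      ∃ C, 0 ≤ C ∧ ∀ ξ, ‖𝓕 f ξ‖ ≤ C * Real.exp (-(φ ‖ξ‖ * ‖ξ‖)) := by
  obtain ⟨Ψ, hΨ0, hΨ1, hΨ⟩ := exists_dilation_bump d
  obtain ⟨C₀, hC₀, hdec⟩ := Ψ.decay 1 0
  simp only [pow_one, norm_iteratedFDeriv_zero] at hdec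
  obtain ⟨R, hR, hφR⟩ := hφ1
  -- Since ‖η‖‖Ψ(η)‖ ≤ C₀, this scale makes ‖Ψ(a n • ξ)‖ ≤ 1/e as soon as n ≤ φ(n)‖ξ‖.
  set a : ℕ → ℝ := fun n => Real.exp 1 * C₀ * (φ n / n) with ha
  have has : Summable a := hs.mul_left _
  -- Only a tail is used, to make the total radius less than ε; n₀ ≥ 1 avoids the division by zero
  -- in `a 0`.
  obtain ⟨n₀, hn₀, hn₀1⟩ := (((tendsto_sum_nat_add a).eventually_lt_const hε).and
    (eventually_ge_atTop 1)).exists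
  set ρ : ℕ → ℝ := fun j => a (j + n₀) with hρ
  have hcast : ∀ j : ℕ, (0 : ℝ) < (j + n₀ : ℕ) := fun j => by exact_mod_cast (by omega)
  have hρ0 : ∀ j, 0 < ρ j := fun j =>
    mul_pos (mul_pos (Real.exp_pos 1) hC₀) (div_pos (hφ0 _ (hcast j).le) (hcast j))
  have hρs : Summable ρ := (summable_nat_add_iff n₀).2 has
  obtain ⟨f, hf, hfs, hf0, hfb⟩ := exists_contDiff_fourier_le_prod hΨ0 hΨ1 hΨ hρ0 hρs
  refine ⟨f, hf, fun x hx => hfs x (hn₀.le.trans hx), hf0,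
    Real.exp n₀ + Real.exp (φ 0 * R), by positivity, fun ξ => ?_⟩
  rw [add_mul]
  have hφ0' := hφ0 ‖ξ‖ (norm_nonneg _)
  by_cases hξ : ‖ξ‖ < R
  · refine (hfb 0 ξ).trans ?_
    rw [Finset.prod_range_zero, ← Real.exp_add (φ 0 * R)]
    have h1 : φ ‖ξ‖ * ‖ξ‖ ≤ φ 0 * R :=
      mul_le_mul (hφ (Set.mem_Ici.2 le_rfl) (norm_nonneg _) (norm_nonneg _)) hξ.le (norm_nonneg _)
        (hφ0 0 le_rfl).le
    have h2 : 1 ≤ Real.exp (φ 0 * R + -(φ ‖ξ‖ * ‖ξ‖)) := Real.one_le_exp (by linarith)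
    linarith [mul_pos (Real.exp_pos n₀) (Real.exp_pos (-(φ ‖ξ‖ * ‖ξ‖)))]
  · rw [not_lt] at hξ
    have hφle : φ ‖ξ‖ ≤ 1 := (hφ hR (norm_nonneg _) hξ).trans hφR
    -- Every index n with n₀ ≤ n ≤ M gives a factor at most 1/e: φ(‖ξ‖) ≤ 1 forces n ≤ ‖ξ‖, hence
    -- φ(‖ξ‖) ≤ φ(n) and n ≤ φ(n)‖ξ‖. Dropping the indices below n₀ costs exp(n₀).
    set M := ⌊φ ‖ξ‖ * ‖ξ‖⌋₊ with hM
    have hMle : (M : ℝ) ≤ φ ‖ξ‖ * ‖ξ‖ := Nat.floor_le (by positivity)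
    have hMlt : φ ‖ξ‖ * ‖ξ‖ < M + 1 := Nat.lt_floor_add_one _
    have hfac : ∀ j ∈ Finset.range (M + 1 - n₀), ‖Ψ (ρ j • ξ)‖ ≤ Real.exp (-1) := by
      intro j hj
      have hjM : j + n₀ ≤ M := by rw [Finset.mem_range] at hj; omega
      have hn : ((j + n₀ : ℕ) : ℝ) ≤ φ ‖ξ‖ * ‖ξ‖ := le_trans (by exact_mod_cast hjM) hMle
      have hnr : ((j + n₀ : ℕ) : ℝ) ≤ ‖ξ‖ :=
        hn.trans (mul_le_of_le_one_left (norm_nonneg _) hφle)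
      have hn' : ((j + n₀ : ℕ) : ℝ) ≤ φ (j + n₀ : ℕ) * ‖ξ‖ :=
        hn.trans (mul_le_mul_of_nonneg_right (hφ (hcast j).le (norm_nonneg _) hnr)
          (norm_nonneg _))
      have h1 := hdec (ρ j • ξ)
      rw [norm_smul, Real.norm_of_nonneg (hρ0 j).le] at h1
      have h2 : Real.exp 1 * C₀ ≤ ρ j * ‖ξ‖ := by
        simp only [hρ, ha]
        rw [mul_assoc]
        refine le_mul_of_one_le_right (by positivity) ?_
        rw [div_mul_eq_mul_div, le_div_iff₀ (hcast j), one_mul]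
        exact hn'
      have h3 : Real.exp 1 * C₀ * ‖Ψ (ρ j • ξ)‖ ≤ C₀ :=
        (mul_le_mul_of_nonneg_right h2 (norm_nonneg _)).trans h1
      rw [Real.exp_neg, ← one_div, le_div_iff₀ (Real.exp_pos _)]
      refine le_of_mul_le_mul_left ?_ hC₀
      linarith
    have h1 : ‖𝓕 f ξ‖ ≤ Real.exp n₀ * Real.exp (-(φ ‖ξ‖ * ‖ξ‖)) := by
      refine (hfb (M + 1 - n₀) ξ).trans ?_
      refine (Finset.prod_le_prod (fun _ _ => norm_nonneg _) hfac).trans ?_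
      rw [Finset.prod_const, Finset.card_range, ← Real.exp_nat_mul, ← Real.exp_add,
        Real.exp_le_exp]
      have : (M : ℝ) + 1 ≤ (M + 1 - n₀ : ℕ) + n₀ := by exact_mod_cast (by omega)
      linarith
    exact h1.trans (le_add_of_nonneg_right (by positivity))

/-! ### The auxiliary profile 1/√(1+r) -/

theorem antitoneOn_one_div_sqrt : AntitoneOn (fun r : ℝ => 1 / √(1 + r)) (Set.Ici 0) := by
  intro a ha b _ hab
  have : 0 < 1 + a := by linarith [Set.mem_Ici.1 ha]
  exact one_div_le_one_div_of_le (Real.sqrt_pos.2 this) (Real.sqrt_le_sqrt (by linarith))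

theorem summable_one_div_sqrt_div : Summable fun n : ℕ => 1 / √(1 + (n : ℝ)) / n := by
  refine Summable.of_nonneg_of_le (fun n => by positivity) (fun n => ?_)
    (Real.summable_one_div_nat_rpow.2 (show (1 : ℝ) < 3 / 2 by norm_num))
  rcases Nat.eq_zero_or_pos n with rfl | hn
  · simp
  have hn' : (0 : ℝ) < n := by exact_mod_cast hn
  rw [div_div]
  refine one_div_le_one_div_of_le (by positivity) ?_
  rw [show (3 / 2 : ℝ) = 1 / 2 + 1 by norm_num, Real.rpow_add hn', Real.rpow_one,
    ← Real.sqrt_eq_rpow]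
  exact mul_le_mul_of_nonneg_right (Real.sqrt_le_sqrt (by linarith)) hn'.le

theorem sqrt_one_add_sub_one_le {r : ℝ} (hr : 0 ≤ r) : √(1 + r) - 1 ≤ 1 / √(1 + r) * r := by
  have h1 : 1 ≤ √(1 + r) := Real.one_le_sqrt.2 (by linarith)
  rw [one_div_mul_eq_div, le_div_iff₀ (by positivity), sub_mul, Real.mul_self_sqrt (by linarith)]
  linarith

/-- A single term, of order 2k, of the exponential series at √(1+r). -/
theorem one_add_pow_le_exp_sqrt {r : ℝ} (hr : 0 ≤ r) (k : ℕ) :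
    (1 + r) ^ k ≤ (2 * k).factorial * Real.exp (√(1 + r)) := by
  have h := Real.pow_div_factorial_le_exp (√(1 + r)) (Real.sqrt_nonneg _) (2 * k)
  rw [pow_mul, Real.sq_sqrt (by linarith), div_le_iff₀ (by positivity)] at h
  linarith

theorem integrable_exp_neg_sqrt_one_add_norm (d : ℕ) :
    Integrable fun ξ : Rd d => Real.exp (-√(1 + ‖ξ‖)) := by
  have h1 : Integrable fun ξ : Rd d => (1 + ‖ξ‖) ^ (-((d + 1 : ℕ) : ℝ)) :=
    integrable_one_add_norm (by rw [finrank_euclideanSpace_fin]; push_cast; linarith)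
  refine (h1.const_mul ((2 * (d + 1)).factorial : ℝ)).mono
    (by fun_prop) (Eventually.of_forall fun ξ => ?_)
  have h0 : 0 < 1 + ‖ξ‖ := by positivity
  rw [Real.norm_of_nonneg (Real.exp_pos _).le, Real.norm_of_nonneg (by positivity),
    Real.rpow_neg h0.le, Real.rpow_natCast, Real.exp_neg, ← div_eq_mul_inv, ← one_div,
    div_le_div_iff₀ (Real.exp_pos _) (by positivity), one_mul]
  exact one_add_pow_le_exp_sqrt (norm_nonneg ξ) (d + 1)

/-! ### Part (b): test functions with prescribed decay -/

/-- Ingham's construction is applied to φ(r) + 1/√(1+r). The added term makes the profile strictly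
positive, keeps the series convergent, and supplies the extra factor exp(-√(1+‖ξ‖)) up to a factor
e. -/
theorem exists_contDiff_fourier_le_of_inghamIntegral_lt_top {d : ℕ} {θ : Rd d → ℝ}
    (hθ0 : ∀ ξ, 0 ≤ θ ξ) (hθ : RadiallyDecreasing θ)
    (hlim : Tendsto θ (comap (fun ξ : Rd d => ‖ξ‖) atTop) (𝓝 0)) (hI : inghamIntegral θ < ⊤) :
    ∃ f : Rd d → ℂ, ContDiff ℝ ∞ f ∧ HasCompactSupport f ∧ 𝓕 f 0 = 1 ∧
      ∃ C, 0 ≤ C ∧ ∀ ξ, ‖𝓕 f ξ‖ ≤ C * Real.exp (-(θ ξ * ‖ξ‖)) * Real.exp (-√(1 + ‖ξ‖)) := by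
  have hcs : ∀ f : Rd d → ℂ, (∀ x, 1 ≤ ‖x‖ → f x = 0) → HasCompactSupport f := by
    intro f hf
    refine HasCompactSupport.intro (isCompact_closedBall (0 : Rd d) 1) fun x hx => hf x ?_
    rw [mem_closedBall_zero_iff, not_le] at hx
    exact hx.le
  have hs0 : ∀ r : ℝ, 0 ≤ r → 0 < 1 / √(1 + r) := fun r hr => by positivity
  -- Only the products θ(ξ)‖ξ‖ are compared, so that d = 0 is covered by φ = 0.
  have main : ∀ φ : ℝ → ℝ, AntitoneOn φ (Set.Ici 0) → (∀ r, 0 ≤ r → 0 ≤ φ r) →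
      (∃ R, 0 ≤ R ∧ φ R ≤ 1 / 2) → (Summable fun n : ℕ => φ n / n) →
      (∀ ξ, θ ξ * ‖ξ‖ = φ ‖ξ‖ * ‖ξ‖) → ∃ f : Rd d → ℂ, ContDiff ℝ ∞ f ∧ HasCompactSupport f ∧
      𝓕 f 0 = 1 ∧
      ∃ C, 0 ≤ C ∧ ∀ ξ, ‖𝓕 f ξ‖ ≤ C * Real.exp (-(θ ξ * ‖ξ‖)) * Real.exp (-√(1 + ‖ξ‖)) := by
    rintro φ hφ hφ0 ⟨R, hR, hφR⟩ hφs hθφ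
    obtain ⟨f, hf, hfs, hf0, C, hC, hfb⟩ := exists_contDiff_fourier_le_exp d
      (φ := fun r => φ r + 1 / √(1 + r)) (hφ.add antitoneOn_one_div_sqrt)
      (fun r hr => add_pos_of_nonneg_of_pos (hφ0 r hr) (hs0 r hr))
      -- Each summand is at most 1/2 here, since 1/√(1+3) = 1/2.
      ⟨max R 3, by positivity, by
        have h1 : φ (max R 3) ≤ 1 / 2 :=
          (hφ hR (Set.mem_Ici.2 (by positivity)) (le_max_left _ _)).trans hφR
        have h2 : 1 / √(1 + max R 3) ≤ 1 / 2 := by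
          refine one_div_le_one_div_of_le two_pos ?_
          rw [Real.le_sqrt' two_pos]
          linarith [le_max_right R 3]
        linarith⟩
      ((hφs.add summable_one_div_sqrt_div).congr fun n => by rw [add_div]) one_pos
    refine ⟨f, hf, hcs f hfs, hf0, C * Real.exp 1, by positivity, fun ξ => (hfb ξ).trans ?_⟩
    rw [mul_assoc C, mul_assoc C, ← Real.exp_add, ← Real.exp_add, hθφ]
    have := sqrt_one_add_sub_one_le (norm_nonneg ξ)
    gcongr
    rw [add_mul]
    linarith
  rcases eq_or_ne d 0 with rfl | hd
  · refine main (fun _ => 0) antitoneOn_const (fun _ _ => le_rfl) ⟨0, le_rfl, by norm_num⟩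
      (by simp) fun ξ => ?_
    rw [Subsingleton.elim ξ 0]
    simp
  · obtain ⟨φ, hφθ, hφ, hθφ⟩ := hθ.exists_profile hd
    have hφ0 : ∀ r, 0 ≤ φ r := fun r => by
      obtain ⟨ξ, hξ⟩ := hφθ r
      rw [hξ]; exact hθ0 ξ
    refine main φ hφ (fun r _ => hφ0 r) ?_ ?_ fun ξ => by rw [hθφ]
    · have h1 : ∀ᶠ ξ in comap (fun ξ : Rd d => ‖ξ‖) atTop, θ ξ < 1 / 2 :=
        hlim.eventually_lt_const (by norm_num)
      obtain ⟨R, hR⟩ := eventually_atTop.1 (eventually_comap.1 h1)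
      have : NeZero d := ⟨hd⟩
      have hnorm : ‖(EuclideanSpace.single 0 (max R 0) : Rd d)‖ = max R 0 := by simp
      refine ⟨max R 0, le_max_right _ _, ?_⟩
      have h2 := hR (max R 0) (le_max_left _ _) _ hnorm
      rw [hθφ, hnorm] at h2
      exact h2.le
    · have h1 := summable_of_inghamIntegral_lt_top hd hφ hθφ (b := 2 ^ 1) (by norm_num) hφ0 hI
      simpa using (summable_div_of_summable_pow hφ hφ0 1).1 h1

/-- Applying a constant coefficient differential operator: multiplication of the Fourier transform
by a polynomial preserves the class of Fourier transforms of test functions. -/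
theorem exists_schwartz_fourier_eq_eval_mul {d : ℕ} (P : MvPolynomial (Fin d) ℂ) :
    ∀ f : 𝓢(Rd d, ℂ), HasCompactSupport f → ∃ g : 𝓢(Rd d, ℂ), HasCompactSupport g ∧
      ∀ ξ, (𝓕 g) ξ = MvPolynomial.eval (fun i => (ξ i : ℂ)) P * (𝓕 f) ξ := by
  induction P using MvPolynomial.induction_on with
  | C a =>
    intro f hf
    refine ⟨a • f, hf.smul_left (f := fun _ => a), fun ξ => ?_⟩
    rw [FourierTransform.fourier_smul]
    simp
  | add p q hp hq =>
    intro f hf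
    obtain ⟨g, hg, hg'⟩ := hp f hf
    obtain ⟨h, hh, hh'⟩ := hq f hf
    refine ⟨g + h, hg.add hh, fun ξ => ?_⟩
    rw [FourierTransform.fourier_add, add_apply, hg', hh', map_add, add_mul]
  | mul_X p i hp =>
    intro f hf
    obtain ⟨g, hg, hg'⟩ := hp f hf
    set m : Rd d := EuclideanSpace.single i 1
    have hc : HasCompactSupport (∂_{m} g : 𝓢(Rd d, ℂ)) :=
      IsCompact.of_isClosed_subset hg (isClosed_tsupport _)
        (SchwartzMap.tsupport_lineDerivOp_subset m g)
    refine ⟨(2 * Real.pi * Complex.I)⁻¹ • (∂_{m} g : 𝓢(Rd d, ℂ)),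
      hc.smul_left (f := fun _ => (2 * Real.pi * Complex.I)⁻¹), fun ξ => ?_⟩
    have ht : (fun x : Rd d => inner ℝ x m).HasTemperateGrowth :=
      ((innerSL ℝ).flip m).hasTemperateGrowth
    rw [FourierTransform.fourier_smul, SchwartzMap.fourier_lineDerivOp_eq, smul_smul,
      inv_mul_cancel₀ Complex.two_pi_I_ne_zero, one_smul, SchwartzMap.smulLeftCLM_apply_apply ht,
      hg', map_mul, MvPolynomial.eval_X]
    simp only [m, EuclideanSpace.inner_single_right, Complex.real_smul]
    simp
    ring

/-- The ball contains a real cube, a product of infinite sets, and a polynomial vanishing on such a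
product is zero. -/
theorem MvPolynomial.eq_zero_of_eval_eq_zero_of_norm_lt {d : ℕ} {P : MvPolynomial (Fin d) ℂ}
    {δ : ℝ} (hδ : 0 < δ)
    (h : ∀ ξ : Rd d, ‖ξ‖ < δ → MvPolynomial.eval (fun i => (ξ i : ℂ)) P = 0) : P = 0 := by
  have hU : {v : Fin d → ℝ | ‖(WithLp.toLp 2 v : Rd d)‖ < δ} ∈ 𝓝 (0 : Fin d → ℝ) := by
    refine IsOpen.mem_nhds ?_ (by simpa using hδ)
    exact isOpen_lt (PiLp.continuous_toLp 2 _).norm continuous_const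
  obtain ⟨η, hη, hball⟩ := Metric.mem_nhds_iff.1 hU
  refine MvPolynomial.funext_set (fun _ => (fun t : ℝ => (t : ℂ)) '' Set.Ioo (-η) η)
    (fun _ => ?_) fun x hx => ?_
  · exact (Set.Ioo_infinite (by linarith)).image Complex.ofReal_injective.injOn
  · rw [map_zero]
    choose v hv hvx using fun i => hx i trivial
    have h1 : v ∈ Metric.ball (0 : Fin d → ℝ) η := by
      rw [mem_ball_zero_iff, pi_norm_lt_iff hη]
      exact fun i => abs_lt.2 (hv i)
    have h2 := h (WithLp.toLp 2 v) (hball h1)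
    rwa [show (fun i => (((WithLp.toLp 2 v : Rd d) i : ℝ) : ℂ)) = x from _root_.funext hvx] at h2

theorem exists_weightedDecay {d : ℕ} {θ : Rd d → ℝ}
    (hθ0 : ∀ ξ, 0 ≤ θ ξ) (hθ : RadiallyDecreasing θ)
    (hlim : Tendsto θ (comap (fun ξ : Rd d => ‖ξ‖) atTop) (𝓝 0)) (hI : inghamIntegral θ < ⊤)
    {q N : ℝ} (hq : 1 ≤ q) (hN : 0 ≤ N) :
    ∃ f : Rd d → ℂ, ContDiff ℝ ∞ f ∧ HasCompactSupport f ∧ f ≠ 0 ∧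
      WeightedDecay θ q N (𝓕 f) := by
  obtain ⟨f, hf, hfc, hf0, C, hC, hfb⟩ :=
    exists_contDiff_fourier_le_of_inghamIntegral_lt_top hθ0 hθ hlim hI
  refine ⟨f, hf, hfc, ?_, ?_⟩
  · rintro rfl
    simp [Real.fourier_eq] at hf0
  · refine lt_of_le_of_lt (lintegral_mono fun ξ => ENNReal.ofReal_le_ofReal ?_)
      (((integrable_exp_neg_sqrt_one_add_norm d).const_mul (C ^ q)).lintegral_lt_top)
    have h1 : ‖𝓕 f ξ‖ ^ q ≤ C ^ q * Real.exp (-(q * θ ξ * ‖ξ‖)) * Real.exp (-(q * √(1 + ‖ξ‖))) := by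
      refine (Real.rpow_le_rpow (norm_nonneg _) (hfb ξ) (by linarith)).trans_eq ?_
      rw [Real.mul_rpow (by positivity) (by positivity), Real.mul_rpow hC (by positivity),
        ← Real.exp_mul, ← Real.exp_mul]
      congr 3 <;> ring
    have h2 : 1 ≤ (1 + ‖ξ‖) ^ N := Real.one_le_rpow (by linarith [norm_nonneg ξ]) hN
    have h3 : √(1 + ‖ξ‖) ≤ q * √(1 + ‖ξ‖) := le_mul_of_one_le_left (Real.sqrt_nonneg _) hq
    calc ‖𝓕 f ξ‖ ^ q * Real.exp (q * θ ξ * ‖ξ‖) / (1 + ‖ξ‖) ^ N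
        ≤ ‖𝓕 f ξ‖ ^ q * Real.exp (q * θ ξ * ‖ξ‖) := div_le_self (by positivity) h2
      _ ≤ (C ^ q * Real.exp (-(q * θ ξ * ‖ξ‖)) * Real.exp (-(q * √(1 + ‖ξ‖)))) *
          Real.exp (q * θ ξ * ‖ξ‖) := by gcongr
      _ = C ^ q * Real.exp (-(q * √(1 + ‖ξ‖))) := by
          rw [Real.exp_neg (q * θ ξ * ‖ξ‖)]
          field_simp
      _ ≤ C ^ q * Real.exp (-√(1 + ‖ξ‖)) := by gcongr

theorem exists_pointwiseDecay {d : ℕ} {θ : Rd d → ℝ}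
    (hθ0 : ∀ ξ, 0 ≤ θ ξ) (hθ : RadiallyDecreasing θ)
    (hlim : Tendsto θ (comap (fun ξ : Rd d => ‖ξ‖) atTop) (𝓝 0)) (hI : inghamIntegral θ < ⊤)
    {P : MvPolynomial (Fin d) ℂ} (hP : P ≠ 0) :
    ∃ f : Rd d → ℂ, ContDiff ℝ ∞ f ∧ HasCompactSupport f ∧ f ≠ 0 ∧
      ∃ C : ℝ, PointwiseDecay θ C P (𝓕 f) := by
  obtain ⟨f, hf, hfc, hf0, C, hC, hfb⟩ :=
    exists_contDiff_fourier_le_of_inghamIntegral_lt_top hθ0 hθ hlim hI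
  have hfF : ∀ ξ, (𝓕 (hfc.toSchwartzMap hf)) ξ = 𝓕 f ξ := fun ξ => rfl
  obtain ⟨g, hgc, hg⟩ := exists_schwartz_fourier_eq_eval_mul P (hfc.toSchwartzMap hf) hfc
  refine ⟨g, g.smooth ⊤, hgc, fun hg0 => hP ?_, C, Eventually.of_forall fun ξ => ?_⟩
  · have hcont : Continuous (𝓕 f) := (𝓕 (hfc.toSchwartzMap hf)).continuous
    have hne : ∀ᶠ ξ in 𝓝 (0 : Rd d), 𝓕 f ξ ≠ 0 :=
      hcont.continuousAt.eventually_ne (by rw [hf0]; exact one_ne_zero)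
    obtain ⟨δ, hδ, hball⟩ := Metric.eventually_nhds_iff.1 hne
    refine MvPolynomial.eq_zero_of_eval_eq_zero_of_norm_lt hδ fun ξ hξ => ?_
    have h1 := hg ξ
    rw [SchwartzMap.fourier_coe, hg0, hfF] at h1
    have h2 : 𝓕 (0 : Rd d → ℂ) ξ = 0 := by simp [Real.fourier_eq]
    rw [h2] at h1
    exact (mul_eq_zero.1 h1.symm).resolve_right (hball (by simpa using hξ))
  · rw [← SchwartzMap.fourier_coe, hg, norm_mul, hfF]
    have h1 : ‖𝓕 f ξ‖ ≤ C * Real.exp (-(θ ξ * ‖ξ‖)) := by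
      refine (hfb ξ).trans (mul_le_of_le_one_right (by positivity) ?_)
      exact Real.exp_le_one_iff.2 (neg_nonpos.2 (Real.sqrt_nonneg _))
    calc _ ≤ ‖MvPolynomial.eval (fun i => (ξ i : ℂ)) P‖ * (C * Real.exp (-(θ ξ * ‖ξ‖))) := by gcongr
      _ = _ := by ring

/-! ### Duality and injectivity of the Fourier transform -/

theorem integral_fourier_mul_schwartz {d : ℕ} {f : Rd d → ℂ} (hf : Integrable f)
    (ψ : 𝓢(Rd d, ℂ)) : ∫ ξ, 𝓕 f ξ * ψ ξ = ∫ x, f x * (𝓕 ψ) x := by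
  have h := VectorFourier.integral_fourierIntegral_smul_eq_flip (L := innerₗ (Rd d))
    (μ := volume) (ν := volume) Real.continuous_fourierChar continuous_inner hf ψ.integrable
  rw [flip_innerₗ] at h
  exact h

/-- The transform maps the Schwartz space onto itself, so the functions 𝓕 ψ include all real test
functions, and these determine a locally integrable function. -/
theorem ae_eq_zero_of_integral_mul_fourier_schwartz {d : ℕ} {f : Rd d → ℂ}
    (hf : LocallyIntegrable f) (h : ∀ ψ : 𝓢(Rd d, ℂ), ∫ x, f x * (𝓕 ψ) x = 0) :
    ∀ᵐ x, f x = 0 := by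
  refine ae_eq_zero_of_integral_contDiff_smul_eq_zero hf fun g hg hgc => ?_
  have h1 : HasCompactSupport (Complex.ofRealCLM ∘ g) := hgc.comp_left rfl
  have h2 : ContDiff ℝ ∞ (Complex.ofRealCLM ∘ g) := by fun_prop
  have h3 := h (𝓕⁻ (h1.toSchwartzMap h2))
  rw [FourierTransform.fourier_fourierInv_eq] at h3
  rw [← h3]
  refine integral_congr_ae (Eventually.of_forall fun x => ?_)
  change g x • f x = f x * (g x : ℂ)
  rw [Complex.real_smul, mul_comm]

theorem ae_eq_zero_of_fourierInv_eq_zero {d : ℕ} {f : Rd d → ℂ} (hf : Integrable f)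
    (h : ∀ x, 𝓕⁻ f x = 0) : ∀ᵐ x, f x = 0 := by
  refine ae_eq_zero_of_integral_mul_fourier_schwartz hf.locallyIntegrable fun ψ => ?_
  rw [← integral_fourier_mul_schwartz hf]
  refine integral_eq_zero_of_ae (Eventually.of_forall fun x => ?_)
  have h1 := h (-x)
  rw [Real.fourierInv_eq_fourier_neg, neg_neg] at h1
  simp [h1]

theorem aestronglyMeasurable_lpFourier {d : ℕ} {p : ℝ≥0∞} (hp1 : 1 ≤ p) (hp2 : p ≤ 2)
    {f : Rd d → ℂ} (hf : MemLp f p volume) :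
    AEStronglyMeasurable (lpFourier hp1 hp2 hf) volume := by
  refine AEStronglyMeasurable.add ?_ (Lp.aestronglyMeasurable _)
  exact (VectorFourier.fourierIntegral_continuous Real.continuous_fourierChar
    (L := innerₗ (Rd d)) continuous_inner
    (integrable_largePart hp1 hp2 hf)).aestronglyMeasurable

/-- The multiplication formula for the Fourier transform on `L^p`. -/
theorem integral_lpFourier_mul_schwartz {d : ℕ} {p : ℝ≥0∞} (hp1 : 1 ≤ p) (hp2 : p ≤ 2)
    {f : Rd d → ℂ} (hf : MemLp f p volume) (ψ : 𝓢(Rd d, ℂ)) :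
    ∫ ξ, lpFourier hp1 hp2 hf ξ * ψ ξ = ∫ x, f x * (𝓕 ψ) x := by
  have hL := integrable_largePart hp1 hp2 hf
  have hS := memLp_smallPart hp1 hp2 hf
  have hSψ : ∀ (u : Rd d → ℂ) (χ : 𝓢(Rd d, ℂ)), MemLp u 2 volume →
      Integrable fun x => u x * χ x := fun u χ hu => hu.integrable_mul (χ.memLp 2)
  have h1 : Integrable fun ξ => 𝓕 (largePart f) ξ * ψ ξ := by
    refine ψ.integrable.bdd_mul (c := ∫ x, ‖largePart f x‖) ?_ (Eventually.of_forall fun ξ =>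
      VectorFourier.norm_fourierIntegral_le_integral_norm _ _ _ _ _)
    exact (VectorFourier.fourierIntegral_continuous Real.continuous_fourierChar
      (L := innerₗ (Rd d)) continuous_inner hL).aestronglyMeasurable
  have h2 : Integrable fun x => largePart f x * (𝓕 ψ) x := by
    refine hL.mul_bdd (c := SchwartzMap.seminorm ℝ 0 0 (𝓕 ψ))
      (𝓕 ψ).continuous.aestronglyMeasurable
      (Eventually.of_forall fun x => (𝓕 ψ).norm_le_seminorm ℝ x)
  have h3 : ∫ ξ, (𝓕 (hS.toLp (smallPart f)) : Lp ℂ 2 (volume : Measure (Rd d))) ξ * ψ ξ =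
      ∫ x, smallPart f x * (𝓕 ψ) x := by
    -- On L² the Plancherel transform agrees with the transform of tempered distributions, which is
    -- defined by this duality.
    have h4 := congrArg (fun T => T ψ) (Lp.fourier_toTemperedDistribution_eq (hS.toLp (smallPart f)))
    simp only [TemperedDistribution.fourier_apply, Lp.toTemperedDistribution_apply,
      smul_eq_mul] at h4
    calc _ = ∫ ξ, ψ ξ * (𝓕 (hS.toLp (smallPart f)) : Lp ℂ 2 (volume : Measure (Rd d))) ξ := by
          simp_rw [mul_comm]
      _ = ∫ x, (𝓕 ψ) x * (hS.toLp (smallPart f)) x := h4.symm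
      _ = _ := by
          refine integral_congr_ae ?_
          filter_upwards [hS.coeFn_toLp] with x hx
          rw [hx, mul_comm]
  calc ∫ ξ, lpFourier hp1 hp2 hf ξ * ψ ξ
      = ∫ ξ, (𝓕 (largePart f) ξ * ψ ξ +
          (𝓕 (hS.toLp (smallPart f)) : Lp ℂ 2 (volume : Measure (Rd d))) ξ * ψ ξ) := by
        simp only [lpFourier, add_mul]
    _ = (∫ ξ, 𝓕 (largePart f) ξ * ψ ξ) +
          ∫ ξ, (𝓕 (hS.toLp (smallPart f)) : Lp ℂ 2 (volume : Measure (Rd d))) ξ * ψ ξ :=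
        integral_add h1 (hSψ _ ψ (Lp.memLp _))
    _ = (∫ x, largePart f x * (𝓕 ψ) x) + ∫ x, smallPart f x * (𝓕 ψ) x := by
        rw [h3, integral_fourier_mul_schwartz hL]
    _ = ∫ x, (largePart f x * (𝓕 ψ) x + smallPart f x * (𝓕 ψ) x) :=
        (integral_add h2 (hSψ _ (𝓕 ψ) hS)).symm
    _ = _ := by
        refine integral_congr_ae (Eventually.of_forall fun x => ?_)
        simp only [← add_mul]
        congr 1
        exact congrFun (largePart_add_smallPart f) x

theorem ae_eq_zero_of_lpFourier_ae_eq_zero {d : ℕ} {p : ℝ≥0∞} (hp1 : 1 ≤ p) (hp2 : p ≤ 2)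
    {f : Rd d → ℂ} (hf : MemLp f p volume) (h : ∀ᵐ ξ, lpFourier hp1 hp2 hf ξ = 0) :
    ∀ᵐ x, f x = 0 := by
  refine ae_eq_zero_of_integral_mul_fourier_schwartz (hf.locallyIntegrable hp1) fun ψ => ?_
  rw [← integral_lpFourier_mul_schwartz hp1 hp2 hf]
  refine integral_eq_zero_of_ae (h.mono fun ξ hξ => ?_)
  simp [hξ]

/-! ### Both decay conditions reduced to weighted integrability -/

theorem MvPolynomial.exists_norm_eval_le {d : ℕ} (P : MvPolynomial (Fin d) ℂ) :
    ∃ (B : ℝ) (n : ℕ), 0 ≤ B ∧ ∀ ξ : Rd d,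
      ‖MvPolynomial.eval (fun i => (ξ i : ℂ)) P‖ ≤ B * (1 + ‖ξ‖) ^ n := by
  induction P using MvPolynomial.induction_on with
  | C a => exact ⟨‖a‖, 0, norm_nonneg _, fun ξ => by simp⟩
  | add p q hp hq =>
    obtain ⟨B, n, hB, h⟩ := hp
    obtain ⟨B', n', hB', h'⟩ := hq
    refine ⟨B + B', n + n', by positivity, fun ξ => ?_⟩
    have h1 : 1 ≤ 1 + ‖ξ‖ := by linarith [norm_nonneg ξ]
    rw [map_add, add_mul]
    refine (norm_add_le _ _).trans (add_le_add ((h ξ).trans ?_) ((h' ξ).trans ?_)) <;>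
      gcongr <;> omega
  | mul_X p i hp =>
    obtain ⟨B, n, hB, h⟩ := hp
    refine ⟨B, n + 1, hB, fun ξ => ?_⟩
    rw [map_mul, MvPolynomial.eval_X, norm_mul, Complex.norm_real, pow_succ, ← mul_assoc]
    have h1 : ‖ξ i‖ ≤ 1 + ‖ξ‖ := (PiLp.norm_apply_le ξ i).trans (by linarith)
    exact mul_le_mul (h ξ) h1 (norm_nonneg _) (by positivity)

/-- Either decay condition makes `‖F ξ‖ * exp (θ ξ * ‖ξ‖)` integrable against a negative power of
`1 + ‖ξ‖`. -/
theorem exists_integrable_of_decay {d : ℕ} {θ : Rd d → ℝ} (hθ : Measurable θ) {F : Rd d → ℂ}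
    (hF : AEStronglyMeasurable F volume)
    (h : (∃ q N : ℝ, 1 ≤ q ∧ 0 ≤ N ∧ WeightedDecay θ q N F) ∨
      ∃ (C : ℝ) (P : MvPolynomial (Fin d) ℂ), PointwiseDecay θ C P F) :
    ∃ K : ℕ, Integrable fun ξ => ‖F ξ‖ * Real.exp (θ ξ * ‖ξ‖) / (1 + ‖ξ‖) ^ K := by
  have hI : Integrable fun ξ : Rd d => ((1 + ‖ξ‖) ^ (d + 1))⁻¹ := by
    have h1 : Integrable fun ξ : Rd d => (1 + ‖ξ‖) ^ (-((d + 1 : ℕ) : ℝ)) :=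
      integrable_one_add_norm (by rw [finrank_euclideanSpace_fin]; push_cast; linarith)
    refine h1.congr (Eventually.of_forall fun ξ => ?_)
    simp only
    rw [Real.rpow_neg (by positivity), Real.rpow_natCast]
  have hexp : Measurable fun ξ : Rd d => Real.exp (θ ξ * ‖ξ‖) := (hθ.mul measurable_norm).exp
  have hmeas : ∀ K : ℕ, AEStronglyMeasurable
      (fun ξ => ‖F ξ‖ * Real.exp (θ ξ * ‖ξ‖) / (1 + ‖ξ‖) ^ K) volume := fun K =>
    ((hF.norm.aemeasurable.mul hexp.aemeasurable).div
      ((measurable_norm.const_add 1).pow_const K).aemeasurable).aestronglyMeasurable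
  rcases h with ⟨q, N, hq, hN, h⟩ | ⟨C, P, h⟩
  · obtain ⟨n, hn⟩ := exists_nat_ge N
    have hm : AEStronglyMeasurable (fun ξ => ‖F ξ‖ ^ q * Real.exp (q * θ ξ * ‖ξ‖) /
        (1 + ‖ξ‖) ^ N) volume :=
      (((hF.norm.aemeasurable.pow_const q).mul
        (((hθ.const_mul q).mul measurable_norm).exp.aemeasurable)).div
        ((measurable_norm.const_add 1).pow_const N).aemeasurable).aestronglyMeasurable
    have hW := (lintegral_ofReal_ne_top_iff_integrable hm
      (Eventually.of_forall fun ξ => by positivity)).1 (ne_of_lt h)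
    refine ⟨n + (d + 1), (hI.add hW).mono (hmeas _) (Eventually.of_forall fun ξ => ?_)⟩
    have h1 : 1 ≤ 1 + ‖ξ‖ := by linarith [norm_nonneg ξ]
    set y := ‖F ξ‖ * Real.exp (θ ξ * ‖ξ‖) with hy
    have hy0 : 0 ≤ y := by positivity
    have hyq : ‖F ξ‖ ^ q * Real.exp (q * θ ξ * ‖ξ‖) = y ^ q := by
      rw [hy, Real.mul_rpow (norm_nonneg _) (by positivity), ← Real.exp_mul]
      congr 2; ring
    -- This replaces Hölder's inequality: the term 1 is integrable against (1+‖ξ‖)^(-(d+1)), and y^q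
    -- by hypothesis against (1+‖ξ‖)^(-N).
    have hyle : y ≤ 1 + y ^ q := by
      rcases le_total y 1 with h2 | h2
      · linarith [Real.rpow_nonneg hy0 q]
      · linarith [Real.self_le_rpow_of_one_le h2 hq]
    rw [Pi.add_apply, hyq, Real.norm_of_nonneg (by positivity), Real.norm_of_nonneg (by positivity)]
    refine (div_le_div_of_nonneg_right hyle (by positivity)).trans ?_
    rw [add_div, one_div]
    refine add_le_add (inv_anti₀ (by positivity) (pow_le_pow_right₀ h1 (by omega)))
      (div_le_div_of_nonneg_left (by positivity) (by positivity) ?_)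
    rw [← Real.rpow_natCast]
    refine Real.rpow_le_rpow_of_exponent_le h1 (hn.trans ?_)
    push_cast
    linarith [(Nat.cast_nonneg d : (0 : ℝ) ≤ d)]
  · obtain ⟨B, n, hB, hP⟩ := P.exists_norm_eval_le
    refine ⟨n + (d + 1), (hI.const_mul (|C| * B)).mono (hmeas _) (h.mono fun ξ hξ => ?_)⟩
    rw [Real.norm_of_nonneg (by positivity), Real.norm_of_nonneg (by positivity),
      ← div_eq_mul_inv, div_le_div_iff₀ (by positivity) (by positivity)]
    have h1 : ‖F ξ‖ * Real.exp (θ ξ * ‖ξ‖) ≤ |C| * B * (1 + ‖ξ‖) ^ n := by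
      rw [Real.exp_neg, ← div_eq_mul_inv, le_div_iff₀ (Real.exp_pos _)] at hξ
      refine hξ.trans ?_
      rw [mul_assoc]
      exact mul_le_mul (le_abs_self C) (hP ξ) (norm_nonneg _) (abs_nonneg C)
    rw [pow_add (1 + ‖ξ‖) n, ← mul_assoc]
    exact mul_le_mul_of_nonneg_right h1 (by positivity)

/-! ### Part (a): uniqueness -/

/-- If the inverse Fourier transform of a function with non-summable exponential decay vanishes on
a ball, it vanishes everywhere. -/
theorem fourierInv_eq_zero_of_eq_zero_on_ball {d : ℕ} {G : Rd d → ℂ}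
    (hG : AEStronglyMeasurable G volume) {φ : ℝ → ℝ} (hφ : AntitoneOn φ (Set.Ici 0))
    (hlow : ∀ r, 0 ≤ r → 1 / √(1 + r) ≤ φ r)
    (hsum : ¬ Summable fun n : ℕ => φ ((n + 1 : ℝ) ^ 4) / (n + 1))
    (hint : Integrable fun ξ => ‖G ξ‖ * Real.exp (2 * φ ‖ξ‖ * ‖ξ‖)) {x₀ : Rd d} {ε : ℝ}
    (hε : 0 < ε) (h0 : ∀ x, ‖x - x₀‖ < ε → 𝓕⁻ G x = 0) (x : Rd d) : 𝓕⁻ G x = 0 := by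
  obtain ⟨C, hC, hCb⟩ := exists_pow_mul_exp_le_prod hφ hlow
  have hpos : ∀ s, 0 ≤ s → 0 < φ s := fun s hs => lt_of_lt_of_le (by positivity) (hlow s hs)
  set v := x - x₀ with hv
  -- Each derivative in the direction v costs at most 2π‖v‖‖ξ‖; the summand 1 keeps A positive when
  -- v = 0.
  set A := 2 * Real.pi * ‖v‖ + 1 with hA
  have hA0 : 0 < A := by positivity
  set μ : ℕ → ℝ := fun n => A * ((n + 1 : ℝ) / φ ((n + 1 : ℝ) ^ 4)) with hμ
  have hμ0 : ∀ n, 0 < μ n := fun n =>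
    mul_pos hA0 (div_pos (by positivity) (hpos _ (by positivity)))
  have hμmono : Monotone μ := by
    intro m n hmn
    have hmn' : (m : ℝ) ≤ n := by exact_mod_cast hmn
    refine mul_le_mul_of_nonneg_left ?_ hA0.le
    refine div_le_div₀ (by positivity) (by linarith) (hpos _ (by positivity)) ?_
    exact hφ (Set.mem_Ici.2 (by positivity)) (Set.mem_Ici.2 (by positivity)) (by gcongr)
  have hμs : ¬ Summable fun n => 1 / μ n := by
    intro h
    refine hsum ((h.mul_left A).congr fun n => ?_)
    simp only [hμ]
    have := (hpos ((n + 1 : ℝ) ^ 4) (by positivity)).ne'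
    field_simp
  set W : Rd d → ℝ := fun ξ => ‖G ξ‖ * Real.exp (2 * φ ‖ξ‖ * ‖ξ‖) with hW
  -- The n-th t-derivative of the integrand of 𝓕⁻ G at x₀ + t v. Its modulus does not depend on t,
  -- so W gives a dominating function valid for all t.
  set k : ℕ → ℝ → Rd d → ℂ := fun n t ξ => (2 * Real.pi * inner ℝ ξ v * Complex.I) ^ n *
    (Complex.exp (2 * Real.pi * inner ℝ ξ (x₀ + t • v) * Complex.I) * G ξ) with hk
  have hnorm : ∀ n t ξ, ‖k n t ξ‖ = (2 * Real.pi * |inner ℝ ξ v|) ^ n * ‖G ξ‖ := by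
    intro n t ξ
    simp only [hk, norm_mul, norm_pow, Complex.norm_I, mul_one]
    have h1 : ‖Complex.exp (2 * Real.pi * inner ℝ ξ (x₀ + t • v) * Complex.I)‖ = 1 := by
      have := Complex.norm_exp_ofReal_mul_I (2 * Real.pi * inner ℝ ξ (x₀ + t • v))
      push_cast at this
      exact this
    rw [h1, one_mul, Complex.norm_real, Complex.norm_real, Real.norm_of_nonneg Real.pi_pos.le,
      Complex.norm_ofNat, Real.norm_eq_abs]
  have hkb : ∀ n t ξ, ‖k n t ξ‖ ≤ (C * ∏ j ∈ Finset.range n, μ j) * W ξ := by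
    intro n t ξ
    rw [hnorm]
    have h1 : 2 * Real.pi * |inner ℝ ξ v| ≤ A * ‖ξ‖ := by
      have := abs_real_inner_le_norm ξ v
      have h2 : 2 * Real.pi * |inner ℝ ξ v| ≤ 2 * Real.pi * (‖ξ‖ * ‖v‖) := by gcongr
      rw [hA]
      linarith [norm_nonneg ξ]
    have h2 := hCb ‖ξ‖ (norm_nonneg _) n
    rw [Real.exp_neg, ← div_eq_mul_inv, div_le_iff₀ (Real.exp_pos _)] at h2
    calc (2 * Real.pi * |inner ℝ ξ v|) ^ n * ‖G ξ‖
        ≤ (A * ‖ξ‖) ^ n * ‖G ξ‖ := by gcongr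
      _ = A ^ n * ‖ξ‖ ^ n * ‖G ξ‖ := by rw [mul_pow]
      _ ≤ A ^ n * (C * (∏ j ∈ Finset.range n, ((j + 1 : ℝ) / φ ((j + 1 : ℝ) ^ 4))) *
          Real.exp (2 * φ ‖ξ‖ * ‖ξ‖)) * ‖G ξ‖ := by gcongr
      _ = _ := by
          simp only [hμ, hW, Finset.prod_mul_distrib, Finset.prod_const, Finset.card_range]
          ring
  have hkm : ∀ n t, AEStronglyMeasurable (k n t) volume := by
    intro n t
    refine AEStronglyMeasurable.mul ?_ (AEStronglyMeasurable.mul ?_ hG)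
    · exact Continuous.aestronglyMeasurable (by fun_prop)
    · exact Continuous.aestronglyMeasurable (by fun_prop)
  have hki : ∀ n t, Integrable (k n t) := fun n t =>
    (hint.const_mul _).mono' (hkm n t) (Eventually.of_forall (hkb n t))
  set g : ℕ → ℝ → ℂ := fun n t => ∫ ξ, k n t ξ with hg
  have hder : ∀ n t, HasDerivAt (g n) (g (n + 1) t) t := by
    intro n t
    refine (hasDerivAt_integral_of_dominated_loc_of_deriv_le (s := Set.univ) univ_mem
      (Eventually.of_forall fun s => hkm n s) (hki n t) (hkm (n + 1) t)
      (Eventually.of_forall fun ξ s _ => hkb (n + 1) s ξ) (hint.const_mul _)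
      (Eventually.of_forall fun ξ s _ => ?_)).2
    have h1 : HasDerivAt (fun s : ℝ => ((2 * Real.pi * inner ℝ ξ (x₀ + s • v) : ℝ) : ℂ))
        ((2 * Real.pi * inner ℝ ξ v : ℝ) : ℂ) s := by
      refine HasDerivAt.ofReal_comp ?_
      simp only [inner_add_right, real_inner_smul_right]
      simpa using (((hasDerivAt_id s).mul_const (inner ℝ ξ v)).const_add
        (inner ℝ ξ x₀)).const_mul (2 * Real.pi)
    have h2 := (((h1.mul_const Complex.I).cexp).mul_const (G ξ)).const_mul
      ((2 * Real.pi * inner ℝ ξ v * Complex.I) ^ n)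
    simp only [hk]
    convert! h2 using 1
    · funext s
      push_cast
      rfl
    · push_cast
      ring
  have hg0 : ∀ t, g 0 t = 𝓕⁻ G (x₀ + t • v) := by
    intro t
    rw [Real.fourierInv_eq']
    refine integral_congr_ae (Eventually.of_forall fun ξ => ?_)
    simp only [hk, pow_zero, one_mul, smul_eq_mul]
    push_cast
    rfl
  -- Vanishing on a whole neighbourhood of t = 0 is what passes to the derivatives.
  have hloc : ∀ n, g n =ᶠ[𝓝 0] fun _ => 0 := by
    intro n
    induction n with
    | zero =>
      have h1 : Tendsto (fun t : ℝ => ‖t • v‖) (𝓝 0) (𝓝 ‖(0 : ℝ) • v‖) :=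
        Continuous.tendsto (by fun_prop) 0
      rw [zero_smul, norm_zero] at h1
      filter_upwards [h1.eventually_lt_const hε] with t ht
      rw [hg0]
      exact h0 _ (by simpa using ht)
    | succ n ih =>
      have h1 := ih.deriv
      filter_upwards [h1] with t ht
      rw [← (hder n t).deriv, ht, deriv_const]
  have hfin := eq_zero_of_bang (C := C * ∫ ξ, W ξ) hμ0 hμmono
    (mul_nonneg hC (integral_nonneg fun ξ => by positivity)) hμs hder (fun n t => by
      refine (norm_integral_le_of_norm_le (hint.const_mul _)
        (Eventually.of_forall (hkb n t))).trans_eq ?_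
      rw [integral_const_mul]
      ring) (fun n => (hloc n).self_of_nhds) zero_le_one
  rw [hg0, one_smul, hv, add_sub_cancel] at hfin
  exact hfin

/-- Modulated translates of a test function are Fourier transforms of modulated translates of its
Fourier transform. -/
theorem exists_schwartz_fourier_eq_translate {d : ℕ} {g : Rd d → ℂ} (hg : ContDiff ℝ ∞ g) {ε : ℝ}
    (hgs : ∀ x, ε ≤ ‖x‖ → g x = 0) (η x : Rd d) :
    ∃ ψ : 𝓢(Rd d, ℂ), (∀ ξ, ψ ξ = Real.fourierChar (inner ℝ ξ x) • 𝓕 g (ξ - η)) ∧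
      ∀ y, ε ≤ ‖x - y‖ → (𝓕 ψ) y = 0 := by
  set χ : Rd d → ℂ := fun y => Complex.exp (2 * Real.pi * inner ℝ η (x - y) * Complex.I) * g (x - y)
    with hχ
  have hχs : ∀ y, ε ≤ ‖x - y‖ → χ y = 0 := fun y hy => by simp [hχ, hgs _ hy]
  have h1 : HasCompactSupport χ := by
    refine HasCompactSupport.intro (isCompact_closedBall x ε) fun y hy => hχs y ?_
    rw [mem_closedBall_iff_norm, not_le, norm_sub_rev] at hy
    exact hy.le
  have h2 : ContDiff ℝ ∞ χ := by
    have h3 : ContDiff ℝ ∞ fun y : Rd d => ((inner ℝ η (x - y) : ℝ) : ℂ) :=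
      Complex.ofRealCLM.contDiff.comp (contDiff_const.inner ℝ (contDiff_const.sub contDiff_id))
    exact ((contDiff_const.mul h3).mul contDiff_const).cexp.mul
      (hg.comp (contDiff_const.sub contDiff_id))
  refine ⟨𝓕⁻ (h1.toSchwartzMap h2), fun ξ => ?_, fun y hy => ?_⟩
  · rw [SchwartzMap.fourierInv_coe, Real.fourierInv_eq, Real.fourier_eq,
      ← integral_sub_left_eq_self _ volume x, Circle.smul_def,
      ← integral_smul]
    refine integral_congr_ae (Eventually.of_forall fun z => ?_)
    change Real.fourierChar (inner ℝ (x - z) ξ) • χ (x - z) = _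
    simp only [hχ, Circle.smul_def, Real.fourierChar_apply, smul_eq_mul, sub_sub_cancel]
    rw [← mul_assoc, ← mul_assoc, ← Complex.exp_add, ← Complex.exp_add]
    congr 2
    rw [inner_sub_left, inner_sub_right, real_inner_comm z η, real_inner_comm ξ x]
    push_cast
    ring
  · rw [FourierTransform.fourier_fourierInv_eq]
    exact hχs y hy

/-- **Ingham's uniqueness theorem** on `ℝ^d`. -/
theorem ae_eq_zero_of_inghamIntegral_eq_top {d : ℕ} {θ : Rd d → ℝ} (hθ0 : ∀ ξ, 0 ≤ θ ξ)
    (hθm : Measurable θ) (hθ : RadiallyDecreasing θ) (hI : inghamIntegral θ = ⊤)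
    {p : ℝ≥0∞} (hp1 : 1 ≤ p) (hp2 : p ≤ 2) {f : Rd d → ℂ} (hf : MemLp f p volume)
    (hdecay : (∃ q N : ℝ, 1 ≤ q ∧ 0 ≤ N ∧ WeightedDecay θ q N (lpFourier hp1 hp2 hf)) ∨
      ∃ (C : ℝ) (P : MvPolynomial (Fin d) ℂ), PointwiseDecay θ C P (lpFourier hp1 hp2 hf))
    {U : Set (Rd d)} (hU : IsOpen U) (hUne : U.Nonempty) (hfU : ∀ᵐ x : Rd d, x ∈ U → f x = 0) :
    ∀ᵐ x : Rd d, f x = 0 := by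
  -- For d = 0 the domain ‖ξ‖ ≥ 1 is empty, so I = 0.
  have hd : d ≠ 0 := by
    rintro rfl
    have h1 : {ξ : Rd 0 | 1 ≤ ‖ξ‖} = ∅ := by
      ext ξ
      rw [Subsingleton.elim ξ 0]
      simp
    rw [inghamIntegral, h1] at hI
    simp at hI
  obtain ⟨φ, hφθ, hφ, hθφ⟩ := hθ.exists_profile hd
  have hφ0 : ∀ r, 0 ≤ φ r := fun r => by
    obtain ⟨ξ, hξ⟩ := hφθ r
    rw [hξ]; exact hθ0 ξ
  have hφs : ¬ Summable fun n : ℕ => φ ((n : ℝ) ^ 4) / n := by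
    intro h
    have h1 := inghamIntegral_lt_top_of_summable hφ hθφ (b := 2 ^ 4) (by norm_num)
      ((summable_div_of_summable_pow hφ hφ0 4).2 h) hφ0
    exact h1.ne hI
  set F := lpFourier hp1 hp2 hf with hF
  have hFm : AEStronglyMeasurable F volume := aestronglyMeasurable_lpFourier hp1 hp2 hf
  obtain ⟨K, hK⟩ := exists_integrable_of_decay hθm hFm hdecay
  obtain ⟨x₀, hx₀⟩ := hUne
  obtain ⟨ε, hε, hball⟩ := Metric.isOpen_iff.1 hU x₀ hx₀
  -- Of the decay exp(-3√(1+‖ξ‖)), two units pay for the term 1/√(1+r) in φ' below and one for the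
  -- polynomial (1+‖ξ‖)^K. At r = 8 the profile equals 1. The radius ε/2 leaves a ball of radius ε/2
  -- on which the smoothed f vanishes.
  obtain ⟨g, hg, hgs, hg0, C, hC, hgb⟩ := exists_contDiff_fourier_le_exp d
    (φ := fun r => 3 * (1 / √(1 + r)))
    (fun a ha b hb hab => mul_le_mul_of_nonneg_left (antitoneOn_one_div_sqrt ha hb hab) (by norm_num))
    (fun r hr => by positivity)
    ⟨8, by norm_num, by
      rw [show (1 : ℝ) + 8 = 3 ^ 2 by norm_num, Real.sqrt_sq (by norm_num)]; norm_num⟩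
    ((summable_one_div_sqrt_div.mul_left 3).congr fun n => by ring) (half_pos hε)
  have hgc : HasCompactSupport g := by
    refine HasCompactSupport.intro (isCompact_closedBall (0 : Rd d) (ε / 2)) fun x hx => hgs x ?_
    rw [mem_closedBall_zero_iff, not_le] at hx
    exact hx.le
  have hgcont : Continuous (𝓕 g) := (𝓕 (hgc.toSchwartzMap hg)).continuous
  -- Halving φ compensates for the 2 in the weight exp(2φ'(r)r); the second term provides the lower
  -- bound required for the moment estimate.
  set φ' : ℝ → ℝ := fun r => φ r / 2 + 1 / √(1 + r) with hφ'
  have hφ'anti : AntitoneOn φ' (Set.Ici 0) := fun a ha b hb hab =>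
    add_le_add (div_le_div_of_nonneg_right (hφ ha hb hab) two_pos.le)
      (antitoneOn_one_div_sqrt ha hb hab)
  have hφ's : ¬ Summable fun n : ℕ => φ' ((n + 1 : ℝ) ^ 4) / (n + 1) := by
    intro h
    refine hφs ((summable_nat_add_iff 1).1 ?_)
    refine Summable.of_nonneg_of_le (fun n => div_nonneg (hφ0 _) (Nat.cast_nonneg _)) (fun n => ?_)
      (h.mul_left 2)
    push_cast
    rw [← mul_div_assoc]
    refine div_le_div_of_nonneg_right ?_ (by positivity)
    simp only [hφ']
    have : 0 ≤ 1 / √(1 + ((n : ℝ) + 1) ^ 4) := by positivity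
    linarith
  have hGzero : ∀ η : Rd d, ∀ᵐ ξ, F ξ * 𝓕 g (ξ - η) = 0 := by
    intro η
    set G : Rd d → ℂ := fun ξ => F ξ * 𝓕 g (ξ - η) with hG
    have hGm : AEStronglyMeasurable G volume :=
      hFm.mul (hgcont.comp (continuous_id.sub continuous_const)).aestronglyMeasurable
    have hgη : ∀ ξ, ‖𝓕 g (ξ - η)‖ ≤
        C * Real.exp (3 + 3 * √‖η‖) * Real.exp (-(3 * √(1 + ‖ξ‖))) := by
      intro ξ
      refine (hgb _).trans ?_
      rw [mul_assoc C, ← Real.exp_add]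
      gcongr
      have h1 := sqrt_one_add_sub_one_le (norm_nonneg (ξ - η))
      -- Subadditivity of the square root: translating by η costs only a constant depending on η.
      have h2 : √(1 + ‖ξ‖) ≤ √(1 + ‖ξ - η‖) + √‖η‖ := by
        rw [Real.sqrt_le_left (by positivity), add_sq, Real.sq_sqrt (by positivity),
          Real.sq_sqrt (norm_nonneg _)]
        have h3 : ‖ξ‖ ≤ ‖ξ - η‖ + ‖η‖ := by simpa using norm_add_le (ξ - η) η
        have h4 : 0 ≤ 2 * √(1 + ‖ξ - η‖) * √‖η‖ := by positivity
        linarith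
      linarith
    have hWle : ∀ ξ, ‖G ξ‖ * Real.exp (2 * φ' ‖ξ‖ * ‖ξ‖) ≤
        (C * Real.exp (3 + 3 * √‖η‖) * (2 * K).factorial) *
          (‖F ξ‖ * Real.exp (θ ξ * ‖ξ‖) / (1 + ‖ξ‖) ^ K) := by
      intro ξ
      have hr := norm_nonneg ξ
      have h1 : 1 / √(1 + ‖ξ‖) * ‖ξ‖ ≤ √(1 + ‖ξ‖) := by
        rw [one_div_mul_eq_div, div_le_iff₀ (by positivity), Real.mul_self_sqrt (by positivity)]
        linarith
      have h2 : Real.exp (2 * φ' ‖ξ‖ * ‖ξ‖) ≤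
          Real.exp (θ ξ * ‖ξ‖) * Real.exp (2 * √(1 + ‖ξ‖)) := by
        rw [← Real.exp_add, Real.exp_le_exp, hθφ]
        simp only [hφ']
        linarith
      have h3 : Real.exp (-√(1 + ‖ξ‖)) ≤ (2 * K).factorial / (1 + ‖ξ‖) ^ K := by
        rw [Real.exp_neg, ← one_div, div_le_div_iff₀ (Real.exp_pos _) (by positivity), one_mul]
        exact one_add_pow_le_exp_sqrt hr K
      calc ‖G ξ‖ * Real.exp (2 * φ' ‖ξ‖ * ‖ξ‖)
          = ‖F ξ‖ * ‖𝓕 g (ξ - η)‖ * Real.exp (2 * φ' ‖ξ‖ * ‖ξ‖) := by rw [hG, norm_mul]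
        _ ≤ ‖F ξ‖ * (C * Real.exp (3 + 3 * √‖η‖) * Real.exp (-(3 * √(1 + ‖ξ‖)))) *
            (Real.exp (θ ξ * ‖ξ‖) * Real.exp (2 * √(1 + ‖ξ‖))) := by
          gcongr
          exact hgη ξ
        _ = (C * Real.exp (3 + 3 * √‖η‖)) * (‖F ξ‖ * Real.exp (θ ξ * ‖ξ‖)) *
            Real.exp (-√(1 + ‖ξ‖)) := by
          have h4 : Real.exp (-√(1 + ‖ξ‖)) =
              Real.exp (-(3 * √(1 + ‖ξ‖))) * Real.exp (2 * √(1 + ‖ξ‖)) := by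
            rw [← Real.exp_add]; congr 1; ring
          rw [h4]
          ring
        _ ≤ (C * Real.exp (3 + 3 * √‖η‖)) * (‖F ξ‖ * Real.exp (θ ξ * ‖ξ‖)) *
            ((2 * K).factorial / (1 + ‖ξ‖) ^ K) := by gcongr
        _ = _ := by ring
    have hexpm : Measurable fun ξ : Rd d => Real.exp (2 * φ' ‖ξ‖ * ‖ξ‖) := by
      have h1 : (fun ξ : Rd d => Real.exp (2 * φ' ‖ξ‖ * ‖ξ‖)) =
          fun ξ => Real.exp (2 * (θ ξ / 2 + 1 / √(1 + ‖ξ‖)) * ‖ξ‖) := by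
        funext ξ
        rw [hθφ]
      rw [h1]
      fun_prop
    have hWint : Integrable fun ξ => ‖G ξ‖ * Real.exp (2 * φ' ‖ξ‖ * ‖ξ‖) :=
      (hK.const_mul _).mono' (hGm.norm.mul hexpm.aestronglyMeasurable)
        (Eventually.of_forall fun ξ => by
          rw [Real.norm_of_nonneg (by positivity)]
          exact hWle ξ)
    have hlow : ∀ r, 0 ≤ r → 1 / √(1 + r) ≤ φ' r := fun r _ =>
      le_add_of_nonneg_left (div_nonneg (hφ0 r) two_pos.le)
    have hGint : Integrable G := hWint.mono' hGm (Eventually.of_forall fun ξ => by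
      refine le_mul_of_one_le_right (norm_nonneg _) (Real.one_le_exp ?_)
      have h1 : 0 ≤ φ' ‖ξ‖ := le_trans (by positivity) (hlow _ (norm_nonneg ξ))
      positivity)
    refine ae_eq_zero_of_fourierInv_eq_zero hGint
      (fourierInv_eq_zero_of_eq_zero_on_ball hGm hφ'anti hlow hφ's hWint (half_pos hε) (x₀ := x₀)
        fun x hx => ?_)
    -- By the multiplication formula 𝓕⁻ G(x) is the integral of f against 𝓕 ψ, which lives within
    -- ε/2 of x, hence inside U, where f = 0.
    obtain ⟨ψ, hψ, hψs⟩ := exists_schwartz_fourier_eq_translate hg hgs η x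
    have h1 : 𝓕⁻ G x = ∫ ξ, F ξ * ψ ξ := by
      rw [Real.fourierInv_eq]
      refine integral_congr_ae (Eventually.of_forall fun ξ => ?_)
      simp only [hψ, hG, Circle.smul_def, smul_eq_mul]
      ring
    rw [h1, hF, integral_lpFourier_mul_schwartz]
    refine integral_eq_zero_of_ae (hfU.mono fun y hy => ?_)
    simp only [Pi.zero_apply, mul_eq_zero]
    by_cases hxy : ε / 2 ≤ ‖x - y‖
    · exact Or.inr (hψs y hxy)
    · refine Or.inl (hy (hball ?_))
      rw [mem_ball_iff_norm]
      have h2 : ‖y - x₀‖ ≤ ‖y - x‖ + ‖x - x₀‖ := norm_sub_le_norm_sub_add_norm_sub y x x₀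
      rw [norm_sub_rev y x] at h2
      linarith [not_le.1 hxy]
  -- Near each η the factor ĝ(ξ-η) is nonzero, so F vanishes almost everywhere near η; local nullity
  -- then gives global nullity.
  have hne : ∀ᶠ ξ in 𝓝 (0 : Rd d), 𝓕 g ξ ≠ 0 :=
    hgcont.continuousAt.eventually_ne (by rw [hg0]; exact one_ne_zero)
  obtain ⟨δ, hδ, hgδ⟩ := Metric.eventually_nhds_iff.1 hne
  refine ae_eq_zero_of_lpFourier_ae_eq_zero hp1 hp2 hf ?_
  rw [ae_iff]
  refine measure_null_of_locally_null _ fun η _ =>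
    ⟨{ξ | ¬ F ξ = 0} ∩ Metric.ball η δ,
      inter_mem_nhdsWithin _ (Metric.ball_mem_nhds η hδ), ?_⟩
  refine measure_mono_null (fun ξ hξ => ?_) (ae_iff.1 (hGzero η))
  exact mul_ne_zero hξ.1 (hgδ (by simpa [dist_eq_norm] using hξ.2))

theorem theorem2p1 {d : ℕ} (θ : Rd d → ℝ) (hθ_nonneg : ∀ ξ, 0 ≤ θ ξ)
    (hθ_meas : Measurable θ) (hθ_dec : RadiallyDecreasing θ)
    (hθ_lim : Tendsto θ (comap (fun ξ : Rd d => ‖ξ‖) atTop) (𝓝 0)) :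
    (∀ (p : ℝ≥0∞) (hp1 : 1 ≤ p) (hp2 : p ≤ 2) (f : Rd d → ℂ) (hf : MemLp f p volume),
      ((∃ q N : ℝ, 1 ≤ q ∧ 0 ≤ N ∧ WeightedDecay θ q N (lpFourier hp1 hp2 hf)) ∨
        (∃ (C : ℝ) (P : MvPolynomial (Fin d) ℂ),
          PointwiseDecay θ C P (lpFourier hp1 hp2 hf))) →
      (∃ U : Set (Rd d), IsOpen U ∧ U.Nonempty ∧ ∀ᵐ x : Rd d, x ∈ U → f x = 0) →
      inghamIntegral θ = ⊤ →
      ∀ᵐ x : Rd d, f x = 0) ∧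
    (inghamIntegral θ < ⊤ →
      (∀ q N : ℝ, 1 ≤ q → 0 ≤ N →
        ∃ f : Rd d → ℂ, ContDiff ℝ ∞ f ∧ HasCompactSupport f ∧ f ≠ 0 ∧
          WeightedDecay θ q N (𝓕 f)) ∧
      (∀ P : MvPolynomial (Fin d) ℂ, P ≠ 0 →
        ∃ f : Rd d → ℂ, ContDiff ℝ ∞ f ∧ HasCompactSupport f ∧ f ≠ 0 ∧
          ∃ C : ℝ, PointwiseDecay θ C P (𝓕 f))) := by
  refine ⟨?_, fun hI => ⟨fun q N hq hN => ?_, fun P hP => ?_⟩⟩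
  · rintro p hp1 hp2 f hf hdecay ⟨U, hU, hUne, hfU⟩ hI
    exact ae_eq_zero_of_inghamIntegral_eq_top hθ_nonneg hθ_meas hθ_dec hI hp1 hp2 hf hdecay hU hUne
      hfU
  · exact exists_weightedDecay hθ_nonneg hθ_dec hθ_lim hI hq hN
  · exact exists_pointwiseDecay hθ_nonneg hθ_dec hθ_lim hI hP
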